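/- Let $\chi,\Delta_0\in\mathbb{R}$ with $\chi\neq 0$, let $r\in\mathbb{N}$ and $N=r+1$, and let $a,a^\dagger$ be the annihilation and creation operators of a bosonic mode with Fock states $|0\rangle,|1\rangle,\dots$. For $\alpha\in\mathbb{C}$ consider the drive Hamiltonian $$H_{\rm dr}(\alpha)=\tfrac{\chi}{2}a^{\dagger 2}a^2+\Delta_0\,a^\dagger a+\bigl[\chi\alpha\,a^\dagger(a^\dagger a-r)+\text{h.c.}\bigr],$$ and let $\Pi_r=\sum_{n=0}^r|n\rangle\langle n|$ be the projection onto the $N$-dimensional blockade subspace. Put $$H_{d,0}=\sum_{k=0}^{r}E_k|k\rangle\langle k|,\quad E_k=\tfrac{\chi}{2}(k^2-k)+\Delta_0k,$$ $$H_{c,R}=\sum_{k=0}^{r-1}d_k\bigl(|k+1\rangle\langle k|+|k\rangle\langle k+1|\bigr),\quad H_{c,I}=\sum_{k=0}^{r-1}i\,d_k\bigl(|k+1\rangle\langle k|-|k\rangle\langle k+1|\bigr),\quad d_k=(k-r)\sqrt{k+1}.$$ For a control system $H(t)=H_d+\sum_jv_j(t)H_{c,j}$ on $\mathbb{C}^N$,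 its dynamical Lie group is the group generated by the exponentials of the elements of the real Lie algebra generated by $iH_d$ and all $iH_{c,j}$. Assume $r\neq 1-2\Delta_0/\chi$. Then: 1. $\Pi_rH_{\rm dr}(\alpha)\Pi_r=H_{d,0}+\chi\,\mathrm{Re}(\alpha)\,H_{c,R}+\chi\,\mathrm{Im}(\alpha)\,H_{c,I}$ for every $\alpha\in\mathbb{C}$. 2. The dynamical Lie group of the system with drift $H_{d,0}$ and the single control $H_{c,R}$ (that is, with $\mathrm{Im}\,\alpha(t)=0$ for all $t$) contains $SU(N)$, and it equals $U(N)$ if $\mathrm{Tr}\,H_{d,0}\neq0$. The same holds for the system with the two controls $H_{c,R}$ and $H_{c,I}$. 3. Every $V\in SU(N)$, and every $V\in U(N)$ if $\mathrm{Tr}\,H_{d,0}\neq 0$, can be realized exactly with $\mathrm{Im}\,\alpha(t)=0$ for all $t$: there are a time $T>0$ and a bounded measurable real-valued $\alpha(t)$ such that $$V=\mathcal{T}\exp\Bigl[-i\int_0^T\Pi_rH_{\rm dr}(\alpha(t))\Pi_r\,dt\Bigr].$$ -/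

import Mathlib

noncomputable section

namespace KerrControl

attribute [local instance 100] LieRing.ofAssociativeRing

/-! ### The bosonic mode

Operators act on the span of the Fock states `|0⟩, |1⟩, …`, where `|n⟩` is `Finsupp.single n 1`. -/

/-- The annihilation operator: `a |n⟩ = √n |n - 1⟩` (so `a |0⟩ = 0`). -/
def annihilation : Module.End ℂ (ℕ →₀ ℂ) :=
  Finsupp.lsum ℂ fun n => (Real.sqrt n : ℂ) • Finsupp.lsingle (n - 1)

/-- The creation operator: `a† |n⟩ = √(n + 1) |n + 1⟩`. -/
def creation : Module.End ℂ (ℕ →₀ ℂ) :=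
  Finsupp.lsum ℂ fun n => (Real.sqrt (n + 1) : ℂ) • Finsupp.lsingle (n + 1)

/-- The number operator `a† a`. -/
def number : Module.End ℂ (ℕ →₀ ℂ) := creation * annihilation

/-- The drive Hamiltonian
`H_dr = (χ/2) a†² a² + Δ₀ a† a + (χ α a† (a† a - r) + h.c.)` for a displacement `α`. -/
def driveHamiltonian (χ Δ₀ : ℝ) (r : ℕ) (α : ℂ) : Module.End ℂ (ℕ →₀ ℂ) :=
  ((χ / 2 : ℝ) : ℂ) • (creation ^ 2 * annihilation ^ 2) + (Δ₀ : ℂ) • number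
    + ((χ : ℂ) * α) • (creation * (number - (r : ℂ) • 1))
    + ((χ : ℂ) * star α) • ((number - (r : ℂ) • 1) * annihilation)

/-- The compression `Π_r H Π_r` of an operator to the blockade subspace spanned by
`|0⟩, …, |r⟩`, as the matrix with entries `⟨m| H |n⟩`. -/
def blockade (r : ℕ) (H : Module.End ℂ (ℕ →₀ ℂ)) : Matrix (Fin (r + 1)) (Fin (r + 1)) ℂ :=
  Matrix.of fun m n => H (Finsupp.single (n : ℕ) 1) (m : ℕ)

/-- The drift part `∑ E_k |k⟩⟨k|` with `E_k = χ (k² - k) / 2 + Δ₀ k`. -/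
def drift (χ Δ₀ : ℝ) (r : ℕ) : Matrix (Fin (r + 1)) (Fin (r + 1)) ℂ :=
  Matrix.diagonal fun k => ((χ * (((k : ℕ) : ℝ) ^ 2 - ((k : ℕ) : ℝ)) / 2 + Δ₀ * ((k : ℕ) : ℝ) : ℝ) : ℂ)

/-- The couplings `d_k = (k - r) √(k + 1)`, `0 ≤ k < r`. -/
def coupling (r : ℕ) (k : Fin r) : ℝ := (((k : ℕ) : ℝ) - r) * Real.sqrt ((k : ℕ) + 1)

/-- The control part `H_{c,R} = ∑ d_k (|k+1⟩⟨k| + |k⟩⟨k+1|)`. -/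
def controlRe (r : ℕ) : Matrix (Fin (r + 1)) (Fin (r + 1)) ℂ :=
  ∑ k : Fin r, (coupling r k : ℂ) •
    (Matrix.single k.succ k.castSucc 1 + Matrix.single k.castSucc k.succ 1)

/-- The control part `H_{c,I} = ∑ i d_k (|k+1⟩⟨k| - |k⟩⟨k+1|)`. -/
def controlIm (r : ℕ) : Matrix (Fin (r + 1)) (Fin (r + 1)) ℂ :=
  ∑ k : Fin r, (Complex.I * (coupling r k : ℂ)) •
    (Matrix.single k.succ k.castSucc 1 - Matrix.single k.castSucc k.succ 1)

/-! ### Control systems `H(t) = H_d + ∑ j, v_j(t) H_{c,j}` -/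

/-- The dynamical Lie algebra: the real Lie algebra generated by `i H_d` and the `i H_{c,j}`. -/
def dynamicalLieAlgebra {n ι : Type*} [Fintype n] [DecidableEq n]
    (Hd : Matrix n n ℂ) (Hc : ι → Matrix n n ℂ) : LieSubalgebra ℝ (Matrix n n ℂ) :=
  LieSubalgebra.lieSpan ℝ (Matrix n n ℂ)
    (insert (Complex.I • Hd) (Set.range fun j => Complex.I • Hc j))

/-- The dynamical Lie group: the group of matrices generated by the exponentials of the elements
of the dynamical Lie algebra. It is a group because `exp (-X)` is the inverse of `exp X`
(see `exists_inverse_of_mem_dynamicalLieGroup`); it is given as a submonoid of the matrices, like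
`Matrix.unitaryGroup` and `Matrix.specialUnitaryGroup`. -/
def dynamicalLieGroup {n ι : Type*} [Fintype n] [DecidableEq n]
    (Hd : Matrix n n ℂ) (Hc : ι → Matrix n n ℂ) : Submonoid (Matrix n n ℂ) :=
  Submonoid.closure
    {g | ∃ X ∈ dynamicalLieAlgebra Hd Hc, g = NormedSpace.exp X}

theorem exists_inverse_of_mem_dynamicalLieGroup {n ι : Type*} [Fintype n] [DecidableEq n]
    (Hd : Matrix n n ℂ) (Hc : ι → Matrix n n ℂ) {g : Matrix n n ℂ}
    (hg : g ∈ dynamicalLieGroup Hd Hc) :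
    ∃ h ∈ dynamicalLieGroup Hd Hc, g * h = 1 ∧ h * g = 1 := by
  induction hg using Submonoid.closure_induction with
  | mem x hx =>
    obtain ⟨X, hX, rfl⟩ := hx
    refine ⟨NormedSpace.exp (-X),
      Submonoid.subset_closure ⟨-X, neg_mem hX, rfl⟩, ?_, ?_⟩
    · rw [← Matrix.exp_add_of_commute _ _ (Commute.neg_right (Commute.refl X))]; simp
    · rw [← Matrix.exp_add_of_commute _ _ (Commute.neg_left (Commute.refl X))]; simp
  | one => exact ⟨1, one_mem _, by simp⟩
  | mul x y _ _ hx hy =>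
    obtain ⟨a, ha, h1, h2⟩ := hx
    obtain ⟨b, hb, h3, h4⟩ := hy
    refine ⟨b * a, mul_mem hb ha, ?_, ?_⟩
    · rw [mul_assoc, ← mul_assoc y, h3, one_mul, h1]
    · rw [mul_assoc, ← mul_assoc a, h2, one_mul, h4]

/-- `U` is the propagator `U(t) = 𝒯 exp (-i ∫₀ᵗ H(s) ds)` on `[0, T]`: the continuous solution of
`U(t) = 1 - i ∫₀ᵗ H(s) U(s) ds`, for a time-dependent Hamiltonian `H` integrable on `[0, T]`. -/
structure IsPropagator {n : Type*} [Fintype n] [DecidableEq n]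
    (H : ℝ → Matrix n n ℂ) (T : ℝ) (U : ℝ → Matrix n n ℂ) : Prop where
  integrable : ∀ i j, IntervalIntegrable (fun s => H s i j) MeasureTheory.volume 0 T
  continuousOn : ContinuousOn U (Set.Icc 0 T)
  eq : ∀ t ∈ Set.Icc 0 T, ∀ i j,
    U t i j = (1 : Matrix n n ℂ) i j - Complex.I * ∫ s in (0 : ℝ)..t, (H s * U s) i j

/-- The unitary `V` on the blockade subspace is realized as `V = U(T)`, at some time `T > 0`, by the
projected drive Hamiltonian with a bounded measurable `α(t)` satisfying `Im α(t) = 0` for all `t`. -/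
def RealizedByRealDrive (χ Δ₀ : ℝ) (r : ℕ) (V : Matrix (Fin (r + 1)) (Fin (r + 1)) ℂ) : Prop :=
  ∃ T : ℝ, 0 < T ∧ ∃ α : ℝ → ℂ, Measurable α ∧ (∃ C : ℝ, ∀ t, ‖α t‖ ≤ C) ∧
    (∀ t, (α t).im = 0) ∧
    ∃ U : ℝ → Matrix (Fin (r + 1)) (Fin (r + 1)) ℂ,
      IsPropagator (fun t => blockade r (driveHamiltonian χ Δ₀ r (α t))) T U ∧ U T = V

end KerrControl

end

/-! Compressing to `|0⟩, …, |r⟩` gives a tridiagonal system whose Fock-state energy gaps are `χ k +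
Δ₀`. Two gaps with distinct indices `j`, `l` have equal squares exactly when `j + l = m`, where `m =
-2 Δ₀ / χ`. The hypothesis says `m ≠ r - 1`, so one end of the ladder is isolated: the last coupling
if `m < r - 1`, the first if `m > r - 1`. Repeated commutators with the drift then act as an
interpolation polynomial and extract that coupling from the control (`ladder_mem_of_isolated`). The
commutator of its two quadratures is diagonal and detects only the neighbouring couplings, so the
others follow one by one (`ladder_mem_of_adjacent`). All ladder elements together generate the
traceless skew-adjoint matrices; a drift with nonzero trace supplies the missing direction `i 1`.

The Lie groups follow because every (special) unitary is the exponential of a (traceless)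
skew-adjoint matrix. Exact realization needs more, since the drift can only be run forward in time.
A maximal set of attainable directions contains every skew-adjoint one, so the forward semigroup
contains an open piece of the unitary group (`exists_nhds_subset_flowSemigroup`). Recurrence of
powers in a compact group moves that piece to a neighbourhood of `1`, and taking powers reaches
every exponential. If the drift is traceless, the same argument is run with `i 1` adjoined, and the
resulting scalar factor is removed by divisibility of the special unitary group. -/

noncomputable section

namespace KerrControl

open Filter Topology NormedSpace

/-! ### Exact controllability by forward flows in a finite-dimensional C*-algebra -/

section Semigroup

variable {A : Type*} [CStarAlgebra A]

/-- The semigroup generated by the forward flows `exp (t a)`, `0 ≤ t`, of the elements of `𝒜`. -/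
def flowSemigroup (𝒜 : Set A) : Submonoid A :=
  Submonoid.closure {g | ∃ a ∈ 𝒜, ∃ t : ℝ, 0 ≤ t ∧ g = exp (t • a)}

theorem exp_mem_flowSemigroup {𝒜 : Set A} {a : A} (ha : a ∈ 𝒜) {t : ℝ} (ht : 0 ≤ t) :
    exp (t • a) ∈ flowSemigroup 𝒜 :=
  Submonoid.subset_closure ⟨a, ha, t, ht, rfl⟩

theorem flowSemigroup_le_unitary {𝒜 : Set A} (h𝒜 : 𝒜 ⊆ skewAdjoint A) :
    flowSemigroup 𝒜 ≤ unitary A := by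
  let +nondep : NormedAlgebra ℚ A := .restrictScalars ℚ ℂ A
  refine Submonoid.closure_le.2 ?_
  rintro _ ⟨a, ha, t, -, rfl⟩
  exact exp_mem_unitary_of_mem_skewAdjoint (skewAdjoint.smul_mem t (h𝒜 ha))

theorem hasDerivAt_exp_conj (a w : A) :
    HasDerivAt (fun t : ℝ => exp (t • a) * w * exp (t • (-a))) (a * w - w * a) 0 := by
  have h1 := (hasStrictDerivAt_exp_smul_const (𝕂 := ℝ) a 0).hasDerivAt
  have h2 := (hasStrictDerivAt_exp_smul_const (𝕂 := ℝ) (-a) 0).hasDerivAt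
  refine ((h1.mul_const w).mul h2).congr_deriv ?_
  simp [sub_eq_add_neg]

theorem mem_of_hasDerivAt_of_forall_pos {W : Submodule ℝ A} (hW : IsClosed (W : Set A))
    {f : ℝ → A} {f' : A} (hf : HasDerivAt f f' 0) (h : ∀ t, 0 ≤ t → f t ∈ W) : f' ∈ W := by
  have h1 : Tendsto (slope f 0) (𝓝[>] 0) (𝓝 f') :=
    (hasDerivAt_iff_tendsto_slope.1 hf).mono_left (nhdsWithin_mono _ fun x hx => ne_of_gt hx)
  refine hW.mem_of_tendsto h1 ?_
  filter_upwards [self_mem_nhdsWithin] with t ht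
  exact W.smul_mem _ (W.sub_mem (h t (le_of_lt ht)) (h 0 le_rfl))

/-- `𝒜` generates a Lie algebra containing all skew-adjoint elements. -/
def GeneratesSkewAdjoint (𝒜 : Set A) : Prop :=
  ∀ W : Submodule ℝ A, 𝒜 ⊆ W → (∀ x ∈ W, ∀ y ∈ W, x * y - y * x ∈ W) →
    ∀ x ∈ skewAdjoint A, x ∈ W

/-- The span of the conjugates is invariant under conjugation by the semigroup. One-sided
differentiation at time `0` turns this into invariance under commutators with `𝒜`, although inverse
flows are not available. -/
theorem skewAdjoint_le_span_conj [FiniteDimensional ℝ A] {𝒜 : Set A}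
    (h𝒜 : 𝒜 ⊆ skewAdjoint A) (hgen : GeneratesSkewAdjoint 𝒜) {x : A} (hx : x ∈ skewAdjoint A) :
    x ∈ Submodule.span ℝ {y | ∃ s ∈ flowSemigroup 𝒜, ∃ a ∈ 𝒜, y = s * a * star s} := by
  set W := Submodule.span ℝ {y | ∃ s ∈ flowSemigroup 𝒜, ∃ a ∈ 𝒜, y = s * a * star s} with hWdef
  have hconj : ∀ s ∈ flowSemigroup 𝒜, ∀ w ∈ W, s * w * star s ∈ W := by
    intro s hs w hw
    induction hw using Submodule.span_induction with
    | mem y hy =>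
      obtain ⟨s', hs', a, ha, rfl⟩ := hy
      exact Submodule.subset_span ⟨s * s', mul_mem hs hs', a, ha, by simp [mul_assoc]⟩
    | zero => simp
    | add y z _ _ hy hz => simpa [mul_add, add_mul] using add_mem hy hz
    | smul c y _ hy => simpa using W.smul_mem c hy
  have hclosed : IsClosed (W : Set A) := W.closed_of_finiteDimensional
  have had : ∀ a ∈ 𝒜, ∀ w ∈ W, a * w - w * a ∈ W := by
    intro a ha w hw
    refine mem_of_hasDerivAt_of_forall_pos hclosed (hasDerivAt_exp_conj a w) fun t ht => ?_
    have hstar : exp (t • (-a)) = star (exp (t • a)) := by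
      rw [star_exp, star_smul, skewAdjoint.mem_iff.1 (h𝒜 ha)]; simp
    rw [hstar]
    exact hconj _ (exp_mem_flowSemigroup ha ht) w hw
  have hA : 𝒜 ⊆ W := fun a ha =>
    Submodule.subset_span ⟨1, one_mem _, a, ha, by simp⟩
  -- It is not yet known that `W` is a Lie algebra. The elements of `W` whose commutators preserve
  -- `W` do form one, by the Jacobi identity, and they include `𝒜`.
  let N : Submodule ℝ A :=
    { carrier := {x | x ∈ W ∧ ∀ w ∈ W, x * w - w * x ∈ W}
      add_mem' := by
        rintro x y ⟨hx, hx'⟩ ⟨hy, hy'⟩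
        refine ⟨add_mem hx hy, fun w hw => ?_⟩
        convert add_mem (hx' w hw) (hy' w hw) using 1
        noncomm_ring
      zero_mem' := by simp
      smul_mem' := by
        rintro c x ⟨hx, hx'⟩
        refine ⟨W.smul_mem c hx, fun w hw => ?_⟩
        convert W.smul_mem c (hx' w hw) using 1
        simp [smul_sub] }
  refine (hgen N (fun a ha => ⟨hA ha, had a ha⟩) ?_ x hx).1
  rintro x ⟨hx, hx'⟩ y ⟨hy, hy'⟩
  refine ⟨hx' y hy, fun w hw => ?_⟩
  convert sub_mem (hx' _ (hy' w hw)) (hy' _ (hx' w hw)) using 1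
  noncomm_ring

/-- `D` consists of directions in which a differentiable family of elements of `S` moves at some
point. -/
def IsAttainable (S : Submonoid A) (D : Submodule ℝ A) : Prop :=
  ∃ (E : Type) (_ : NormedAddCommGroup E) (_ : NormedSpace ℝ E) (_ : CompleteSpace E)
    (F : E → A) (F' : E →L[ℝ] A) (x₀ : E), HasStrictFDerivAt F F' x₀ ∧
      (∀ᶠ x in 𝓝 x₀, F x ∈ S) ∧ ∀ v ∈ D, ∃ h, F' h = v * F x₀

theorem isAttainable_bot (S : Submonoid A) : IsAttainable S (⊥ : Submodule ℝ A) :=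
  ⟨ℝ, inferInstance, inferInstance, inferInstance, fun _ => 1, 0, 0,
    hasStrictFDerivAt_const _ _, by simp [S.one_mem], fun v hv => ⟨0, by simp_all⟩⟩

/-- If every conjugate, transported to the base point `p`, lay in `D`, then `D` would contain all
skew-adjoint elements. So some transported conjugate `v` is missing, and the family `F x * s * exp
(t • a)` near `t = 1` gains it. Right multiplication leaves the old directions unchanged, because
directions are measured by left factors. Taking the base time `1` keeps nearby times positive. -/
theorem IsAttainable.exists_gt [FiniteDimensional ℝ A] {𝒜 : Set A}
    (h𝒜 : 𝒜 ⊆ skewAdjoint A) (hgen : GeneratesSkewAdjoint 𝒜) {D : Submodule ℝ A}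
    (hD : IsAttainable (flowSemigroup 𝒜) D) {x : A} (hx : x ∈ skewAdjoint A) (hxD : x ∉ D) :
    ∃ D', D < D' ∧ IsAttainable (flowSemigroup 𝒜) D' := by
  obtain ⟨E, _, _, _, F, F', x₀, hF, hS, hF'⟩ := hD
  set p := F x₀ with hp
  have hpS : p ∈ flowSemigroup 𝒜 := hS.self_of_nhds
  have hpu : p ∈ unitary A := flowSemigroup_le_unitary h𝒜 hpS
  obtain ⟨hp1, hp2⟩ := Unitary.mem_iff.1 hpu
  obtain ⟨s, hs, a, ha, hsa⟩ :
      ∃ s ∈ flowSemigroup 𝒜, ∃ a ∈ 𝒜, p * (s * a * star s) * star p ∉ D := by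
    by_contra! hcon
    let c : A →ₗ[ℝ] A := LinearMap.mulRight ℝ (star p) ∘ₗ LinearMap.mulLeft ℝ p
    have hle : Submodule.span ℝ {y | ∃ s ∈ flowSemigroup 𝒜, ∃ a ∈ 𝒜, y = s * a * star s}
        ≤ D.comap c := by
      refine Submodule.span_le.2 ?_
      rintro _ ⟨s, hs, a, ha, rfl⟩
      exact hcon s hs a ha
    have hx' : star p * x * p ∈ skewAdjoint A := by
      rw [skewAdjoint.mem_iff] at hx ⊢
      simp [hx, mul_assoc]
    have h1 := hle (skewAdjoint_le_span_conj h𝒜 hgen hx')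
    refine hxD ?_
    have h2 : c (star p * x * p) = x := by
      simp only [c, LinearMap.comp_apply, LinearMap.mulLeft_apply, LinearMap.mulRight_apply]
      calc p * (star p * x * p) * star p = (p * star p) * x * (p * star p) := by noncomm_ring
        _ = x := by simp [hp2]
    rw [← h2]; exact h1
  have hsu := flowSemigroup_le_unitary h𝒜 hs
  obtain ⟨hs1, hs2⟩ := Unitary.mem_iff.1 hsu
  set v := p * (s * a * star s) * star p with hv
  have hvp : p * s * (a * exp ((1 : ℝ) • a)) = v * (p * s * exp ((1 : ℝ) • a)) := by
    calc p * s * (a * exp ((1 : ℝ) • a)) = p * s * a * exp ((1 : ℝ) • a) := by noncomm_ring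
      _ = p * (s * a * (star s * ((star p * p) * s))) * exp ((1 : ℝ) • a) := by
        simp [hp1, hs1, mul_assoc]
      _ = _ := by rw [hv]; noncomm_ring
  have h1 : HasStrictFDerivAt (fun y : E × ℝ => F y.1)
      (F'.comp (ContinuousLinearMap.fst ℝ E ℝ)) (x₀, (1 : ℝ)) :=
    HasStrictFDerivAt.comp (x₀, (1 : ℝ)) hF hasStrictFDerivAt_fst
  have h2 := HasStrictFDerivAt.comp (g := fun u : ℝ => exp (u • a)) (x₀, (1 : ℝ))
    (hasStrictDerivAt_exp_smul_const' (𝕂 := ℝ) a 1).hasStrictFDerivAt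
    (hasStrictFDerivAt_snd (𝕜 := ℝ) (E := E) (F := ℝ))
  refine ⟨D ⊔ Submodule.span ℝ {v}, ?_, E × ℝ, inferInstance, inferInstance, inferInstance,
    fun y => F y.1 * s * exp (y.2 • a), _, (x₀, 1), (h1.mul_const' s).mul' h2, ?_, ?_⟩
  · refine lt_of_le_of_ne le_sup_left fun h => hsa ?_
    rw [h]
    exact Submodule.mem_sup_right (Submodule.mem_span_singleton_self v)
  · have h1 : ∀ᶠ y : E × ℝ in 𝓝 (x₀, (1 : ℝ)), F y.1 ∈ flowSemigroup 𝒜 :=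
      (continuous_fst.tendsto (x₀, (1 : ℝ))).eventually hS
    have h2 : ∀ᶠ y : E × ℝ in 𝓝 (x₀, (1 : ℝ)), 0 < y.2 :=
      (continuous_snd.tendsto (x₀, (1 : ℝ))).eventually (lt_mem_nhds one_pos)
    filter_upwards [h1, h2] with y hy1 hy2
    exact mul_mem (mul_mem hy1 hs) (exp_mem_flowSemigroup ha hy2.le)
  · intro w hw
    obtain ⟨d, hd, z, hz, rfl⟩ := Submodule.mem_sup.1 hw
    obtain ⟨c, rfl⟩ := Submodule.mem_span_singleton.1 hz
    obtain ⟨h, hh⟩ := hF' d hd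
    refine ⟨(h, c), ?_⟩
    simp only [add_mul, smul_mul_assoc, ← hp, ← hvp]
    simp [hh, mul_assoc, add_comm]

theorem isAttainable_skewAdjoint [FiniteDimensional ℝ A] {𝒜 : Set A}
    (h𝒜 : 𝒜 ⊆ skewAdjoint A) (hgen : GeneratesSkewAdjoint 𝒜) :
    ∃ D, IsAttainable (flowSemigroup 𝒜) D ∧ ∀ x ∈ skewAdjoint A, x ∈ D := by
  obtain ⟨D, hD, hmax⟩ := WellFounded.has_min (wellFounded_gt (α := Submodule ℝ A))
    {D | IsAttainable (flowSemigroup 𝒜) D} ⟨⊥, isAttainable_bot _⟩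
  refine ⟨D, hD, fun x hx => ?_⟩
  by_contra hxD
  obtain ⟨D', hlt, hD'⟩ := IsAttainable.exists_gt h𝒜 hgen hD hx hxD
  exact hmax D' hD' hlt

/-- Here `exp P` is self-adjoint and unitary, so `exp (2 P) = 1`, and the logarithm is injective on
such exponentials. -/
theorem eq_zero_of_exp_mem_unitary {P : A} (hP : IsSelfAdjoint P) (h : exp P ∈ unitary A) :
    P = 0 := by
  let +nondep : NormedAlgebra ℚ A := .restrictScalars ℚ ℂ A
  have h1 : star (exp P) = exp P := by rw [star_exp, hP.star_eq]
  have h2 : exp ((2 : ℝ) • P) = exp 0 := by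
    rw [two_smul, exp_add_of_commute (Commute.refl P), exp_zero]
    have := (Unitary.mem_iff.1 h).1
    rwa [h1] at this
  have h3 := congrArg CFC.log h2
  rw [CFC.log_exp _ (IsSelfAdjoint.smul (by simp [IsSelfAdjoint]) hP), CFC.log_exp _ (.zero A)] at h3
  simpa using h3

/-- The reachable semigroup has an interior point in the unitary group. -/
theorem exists_nhds_subset_flowSemigroup [FiniteDimensional ℝ A] {𝒜 : Set A}
    (h𝒜 : 𝒜 ⊆ skewAdjoint A) (hgen : GeneratesSkewAdjoint 𝒜) :
    ∃ u ∈ flowSemigroup 𝒜, ∀ᶠ V in 𝓝 u, V ∈ unitary A → V ∈ flowSemigroup 𝒜 := by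
  obtain ⟨D, ⟨E, _, _, _, F, F', x₀, hF, hS, hF'⟩, hD⟩ := isAttainable_skewAdjoint h𝒜 hgen
  have hpS := hS.self_of_nhds
  obtain ⟨hp1, hp2⟩ := Unitary.mem_iff.1 (flowSemigroup_le_unitary h𝒜 hpS)
  refine ⟨F x₀, hpS, ?_⟩
  -- To apply the open mapping form of the inverse function theorem in the ambient algebra, the
  -- family is thickened to `(x, P) ↦ exp P * F x` with `P` self-adjoint: `F` provides the
  -- skew-adjoint directions and `P` the complementary ones.
  let H := selfAdjoint.submodule ℝ A
  let ι : H →L[ℝ] A := H.subtypeL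
  have h1 : HasStrictFDerivAt (fun y : E × H => F y.1)
      (F'.comp (ContinuousLinearMap.fst ℝ E H)) (x₀, (0 : H)) :=
    HasStrictFDerivAt.comp (x₀, (0 : H)) hF hasStrictFDerivAt_fst
  have h0 : HasStrictFDerivAt (exp : A → A) (1 : A →L[ℝ] A)
      ((ι.comp (ContinuousLinearMap.snd ℝ E H)) (x₀, (0 : H))) := by
    simpa using hasStrictFDerivAt_exp_zero (𝕂 := ℝ) (𝔸 := A)
  have h2 := HasStrictFDerivAt.comp (x₀, (0 : H)) h0
    (ι.comp (ContinuousLinearMap.snd ℝ E H)).hasStrictFDerivAt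
  have h3 := h2.mul' h1
  have hsurj := h3.map_nhds_eq_of_surj (LinearMap.range_eq_top.2 fun y => by
    have hy : y * star (F x₀) * F x₀ = y := by rw [mul_assoc, hp1, mul_one]
    set z := y * star (F x₀) with hz
    obtain ⟨h, hh⟩ := hF' ((2⁻¹ : ℝ) • (z - star z)) (hD _ (by
      rw [skewAdjoint.mem_iff]; simp [← smul_neg]))
    refine ⟨(h, ⟨(2⁻¹ : ℝ) • (z + star z), ?_⟩), ?_⟩
    · change IsSelfAdjoint _
      rw [isSelfAdjoint_iff]; simp [add_comm]
    · simp [hh, ι, ← add_mul, ← smul_add]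
      rw [← two_smul ℝ z, smul_mul_assoc, smul_smul, hy]
      norm_num)
  have hval : exp ((ι.comp (ContinuousLinearMap.snd ℝ E H)) (x₀, (0 : H))) * F x₀ = F x₀ := by
    simp
  simp only [Pi.mul_apply, hval] at hsurj
  rw [← hsurj, eventually_map]
  filter_upwards [(continuous_fst.tendsto (x₀, (0 : H))).eventually hS] with y hy hu
  -- A unitary value of the thickened family has `exp P` unitary, hence `P = 0`, and is therefore a
  -- value of `F`.
  have hyu := flowSemigroup_le_unitary h𝒜 hy
  have hP : exp (y.2 : A) ∈ unitary A := by
    have h4 := mul_mem hu (Unitary.star_mem hyu)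
    simpa [mul_assoc, (Unitary.mem_iff.1 hyu).2, ι] using h4
  have := eq_zero_of_exp_mem_unitary y.2.2 hP
  simpa [ι, this] using hy

/-- The powers lie in a compact ball, so two of them are close; multiplication by a unitary is
isometric, so their quotient is close to `1`. -/
theorem exists_pow_norm_sub_one_lt [FiniteDimensional ℝ A] {u : A} (hu : u ∈ unitary A) {ε : ℝ}
    (hε : 0 < ε) : ∃ n : ℕ, ‖u ^ (n + 1) - 1‖ < ε := by
  have : ProperSpace A := FiniteDimensional.proper ℝ A
  have hb : ∀ n : ℕ, u ^ n ∈ Metric.closedBall (0 : A) ‖(1 : A)‖ := fun n => by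
    have h := CStarRing.norm_coe_unitary_mul (⟨u ^ n, pow_mem hu n⟩ : unitary A) 1
    simpa using h.le
  obtain ⟨a, -, φ, hφ, hlim⟩ := (isCompact_closedBall (0 : A) ‖(1 : A)‖).tendsto_subseq hb
  obtain ⟨N, hN⟩ := Metric.cauchySeq_iff.1 hlim.cauchySeq ε hε
  have h1 := hN (N + 1) (by simp) N le_rfl
  have hlt : φ N < φ (N + 1) := hφ (by simp)
  obtain ⟨k, hk⟩ := Nat.exists_eq_add_of_lt hlt
  refine ⟨k, ?_⟩
  have h2 := CStarRing.norm_coe_unitary_mul (⟨u ^ φ N, pow_mem hu _⟩ : unitary A) (u ^ (k + 1) - 1)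
  rw [← h2, mul_sub, ← pow_add, mul_one, ← dist_eq_norm, ← add_assoc, ← hk]
  exact h1

/-- Write `V = u ^ n * (star (u ^ n) * V)`. If `u ^ (n + 1)` and `V` are both near `1`, the second
factor is near the interior point `u`. -/
theorem eventually_mem_flowSemigroup [FiniteDimensional ℝ A] {𝒜 : Set A}
    (h𝒜 : 𝒜 ⊆ skewAdjoint A) (hgen : GeneratesSkewAdjoint 𝒜) :
    ∀ᶠ V in 𝓝 (1 : A), V ∈ unitary A → V ∈ flowSemigroup 𝒜 := by
  obtain ⟨u, hu, hnhds⟩ := exists_nhds_subset_flowSemigroup h𝒜 hgen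
  have huu := flowSemigroup_le_unitary h𝒜 hu
  obtain ⟨ε, hε, hball⟩ := Metric.eventually_nhds_iff.1 hnhds
  obtain ⟨n, hn⟩ := exists_pow_norm_sub_one_lt huu (half_pos hε)
  rw [Metric.eventually_nhds_iff]
  refine ⟨ε / 2, half_pos hε, fun V hV hVu => ?_⟩
  have hnu := pow_mem huu n
  have h1 : star (u ^ n) * V ∈ flowSemigroup 𝒜 := by
    refine hball ?_ (mul_mem (Unitary.star_mem hnu) hVu)
    have h2 := CStarRing.norm_coe_unitary_mul (⟨u ^ n, hnu⟩ : unitary A) (star (u ^ n) * V - u)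
    rw [dist_eq_norm, ← h2, mul_sub, ← mul_assoc, (Unitary.mem_iff.1 hnu).2, one_mul, ← pow_succ]
    calc ‖V - u ^ (n + 1)‖ = ‖(V - 1) - (u ^ (n + 1) - 1)‖ := by congr 1; abel
      _ ≤ ‖V - 1‖ + ‖u ^ (n + 1) - 1‖ := norm_sub_le _ _
      _ < ε / 2 + ε / 2 := add_lt_add (by rwa [← dist_eq_norm]) hn
      _ = ε := add_halves ε
  have h3 := mul_mem (pow_mem hu n) h1
  rwa [← mul_assoc, (Unitary.mem_iff.1 hnu).2, one_mul] at h3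

/-- **Exact controllability**: if the generators span the Lie algebra of the unitary group, then
every exponential of a skew-adjoint element is reached by forward flows. -/
theorem exp_mem_flowSemigroup_of_generates [FiniteDimensional ℝ A] {𝒜 : Set A}
    (h𝒜 : 𝒜 ⊆ skewAdjoint A) (hgen : GeneratesSkewAdjoint 𝒜) {X : A} (hX : X ∈ skewAdjoint A) :
    exp X ∈ flowSemigroup 𝒜 := by
  have hlim : Tendsto (fun t : ℝ => exp (t • X)) (𝓝 0) (𝓝 (1 : A)) := by
    have := (hasStrictDerivAt_exp_smul_const (𝕂 := ℝ) X 0).hasDerivAt.continuousAt.tendsto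
    simpa using this
  let +nondep : NormedAlgebra ℚ A := .restrictScalars ℚ ℂ A
  have hlim' := hlim.comp (tendsto_one_div_add_atTop_nhds_zero_nat (𝕜 := ℝ))
  obtain ⟨k, hk⟩ := (hlim'.eventually (eventually_mem_flowSemigroup h𝒜 hgen)).exists
  have h1 := hk (exp_mem_unitary_of_mem_skewAdjoint (skewAdjoint.smul_mem _ hX))
  have h2 := pow_mem h1 (k + 1)
  have h3 : (exp ((1 / ((k : ℝ) + 1)) • X)) ^ (k + 1) = exp X := by
    rw [← exp_nsmul, ← Nat.cast_smul_eq_nsmul ℝ, smul_smul]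
    congr 1
    have : ((k : ℝ) + 1) ≠ 0 := by positivity
    push_cast
    rw [mul_one_div_cancel this, one_smul]
  exact h3 ▸ h2

end Semigroup

end KerrControl

end

noncomputable section

namespace KerrControl

open Filter Topology NormedSpace

/-! ### Logarithms, determinants and roots in the unitary groups -/

section Unitary

variable {n : Type*} [Fintype n] [DecidableEq n]

open scoped Matrix.Norms.L2Operator in
theorem exists_skewAdjoint_exp_eq {V : Matrix n n ℂ} (hV : V ∈ Matrix.unitaryGroup n ℂ) :
    ∃ X ∈ skewAdjoint (Matrix n n ℂ), exp X = V := by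
  have hfin := V.finite_spectrum
  have hn : IsStarNormal V := ⟨by
    obtain ⟨h1, h2⟩ := Unitary.mem_iff.1 hV
    rw [Commute, SemiconjBy, h1, h2]⟩
  have hnorm : ∀ z ∈ spectrum ℂ V, ‖z‖ = 1 := fun z hz => spectrum.norm_eq_one_of_unitary hV hz
  -- The branch cut is harmless: every function is continuous on a finite spectrum.
  have hlog : ContinuousOn Complex.log (spectrum ℂ V) := hfin.continuousOn _
  refine ⟨cfc Complex.log V, ?_, ?_⟩
  · rw [skewAdjoint.mem_iff, ← cfc_star, ← cfc_neg]
    refine cfc_congr fun z hz => ?_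
    have hre : (Complex.log z).re = 0 := by simp [Complex.log_re, hnorm z hz]
    apply Complex.ext <;> simp [hre]
  · rw [← CFC.complex_exp_eq_normedSpace_exp (cfc_predicate _ _), ← cfc_comp Complex.exp Complex.log V]
    conv_rhs => rw [← cfc_id ℂ V]
    refine cfc_congr fun z hz => ?_
    have hz0 : z ≠ 0 := fun h => by simpa [h] using hnorm z hz
    simp [Complex.exp_log hz0]

theorem exp_conj_diagonal {W : Matrix n n ℂ} (hW : W ∈ Matrix.unitaryGroup n ℂ) (v : n → ℂ) :
    exp (W * Matrix.diagonal v * star W) =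
      W * Matrix.diagonal (fun i => Complex.exp (v i)) * star W := by
  have h := Matrix.exp_units_conj (Unitary.toUnits ⟨W, hW⟩) (Matrix.diagonal v)
  rw [Matrix.exp_diagonal] at h
  have h2 : exp v = fun i => Complex.exp (v i) := by
    ext i; rw [Pi.coe_exp, Complex.exp_eq_exp_ℂ]
  rw [h2] at h
  exact h

theorem exists_diagonal_of_skewAdjoint {X : Matrix n n ℂ} (hX : X ∈ skewAdjoint (Matrix n n ℂ)) :
    ∃ W ∈ Matrix.unitaryGroup n ℂ, ∃ θ : n → ℝ,
      X = W * Matrix.diagonal (fun i => Complex.I * (θ i : ℂ)) * star W := by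
  have hH : (-Complex.I • X).IsHermitian := by
    rw [Matrix.IsHermitian, ← Matrix.star_eq_conjTranspose, star_smul, skewAdjoint.mem_iff.1 hX]
    simp
  refine ⟨hH.eigenvectorUnitary, hH.eigenvectorUnitary.2, hH.eigenvalues, ?_⟩
  have h := congrArg (fun Y => Complex.I • Y) hH.spectral_theorem
  simp only [Unitary.conjStarAlgAut_apply] at h
  rw [smul_smul] at h
  simp only [mul_neg, Complex.I_mul_I, neg_neg, one_smul] at h
  rw [← smul_mul_assoc, ← mul_smul_comm, ← Matrix.diagonal_smul] at h
  exact h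

theorem trace_conj_diagonal {W : Matrix n n ℂ} (hW : W ∈ Matrix.unitaryGroup n ℂ) (v : n → ℂ) :
    (W * Matrix.diagonal v * star W).trace = ∑ i, v i := by
  rw [Matrix.trace_mul_comm, ← mul_assoc, (Unitary.mem_iff.1 hW).1, one_mul, Matrix.trace_diagonal]

theorem det_conj_diagonal {W : Matrix n n ℂ} (hW : W ∈ Matrix.unitaryGroup n ℂ) (v : n → ℂ) :
    (W * Matrix.diagonal v * star W).det = ∏ i, v i := by
  rw [Matrix.det_mul_comm, ← mul_assoc, (Unitary.mem_iff.1 hW).1, one_mul, Matrix.det_diagonal]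

theorem skewAdjoint_conj_diagonal (W : Matrix n n ℂ) (θ : n → ℝ) :
    W * Matrix.diagonal (fun i => Complex.I * (θ i : ℂ)) * star W ∈
      skewAdjoint (Matrix n n ℂ) := by
  rw [skewAdjoint.mem_iff, star_mul, star_mul, star_star, ← mul_assoc, ← neg_mul, ← mul_neg,
    Matrix.star_eq_conjTranspose (Matrix.diagonal _), Matrix.diagonal_conjTranspose,
    Matrix.diagonal_neg]
  congr 3
  ext i; simp

theorem det_exp_of_skewAdjoint {X : Matrix n n ℂ} (hX : X ∈ skewAdjoint (Matrix n n ℂ)) :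
    (exp X).det = Complex.exp X.trace := by
  obtain ⟨W, hW, θ, rfl⟩ := exists_diagonal_of_skewAdjoint hX
  rw [exp_conj_diagonal hW, det_conj_diagonal hW, trace_conj_diagonal hW, Complex.exp_sum]

theorem exp_mem_unitaryGroup {X : Matrix n n ℂ} (hX : X ∈ skewAdjoint (Matrix n n ℂ)) :
    exp X ∈ Matrix.unitaryGroup n ℂ := by
  obtain ⟨W, hW, θ, rfl⟩ := exists_diagonal_of_skewAdjoint hX
  rw [exp_conj_diagonal hW]
  refine mul_mem (mul_mem hW ?_) (Unitary.star_mem hW)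
  rw [Matrix.mem_unitaryGroup_iff, Matrix.star_eq_conjTranspose, Matrix.diagonal_conjTranspose,
    Matrix.diagonal_mul_diagonal, ← Matrix.diagonal_one]
  congr 1
  ext i
  simp [← Complex.exp_conj, ← Complex.exp_add]

theorem exists_traceless_skewAdjoint_exp_eq [Nonempty n] {V : Matrix n n ℂ}
    (hV : V ∈ Matrix.specialUnitaryGroup n ℂ) :
    ∃ X ∈ skewAdjoint (Matrix n n ℂ), X.trace = 0 ∧ exp X = V := by
  obtain ⟨hVu, hVd⟩ := Matrix.mem_specialUnitaryGroup_iff.1 hV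
  obtain ⟨X, hX, rfl⟩ := exists_skewAdjoint_exp_eq hVu
  rw [det_exp_of_skewAdjoint hX] at hVd
  obtain ⟨m, hm⟩ := Complex.exp_eq_one_iff.1 hVd
  obtain ⟨W, hW, θ, rfl⟩ := exists_diagonal_of_skewAdjoint hX
  obtain ⟨i₀⟩ := ‹Nonempty n›
  -- Determinant `1` only makes the trace of the logarithm equal to `2πi m`. Lowering a single
  -- eigenphase by `2π m` kills the trace without changing the exponential.
  refine ⟨_, skewAdjoint_conj_diagonal W (θ - Pi.single i₀ (2 * Real.pi * m)), ?_, ?_⟩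
  · rw [trace_conj_diagonal hW] at hm ⊢
    simp only [Pi.sub_apply, Complex.ofReal_sub, mul_sub, Finset.sum_sub_distrib, hm]
    rw [← Finset.mul_sum, ← Complex.ofReal_sum, Finset.sum_pi_single']
    simp; ring
  · rw [exp_conj_diagonal hW, exp_conj_diagonal hW]
    congr 3
    ext i
    rcases eq_or_ne i i₀ with rfl | h
    · simp only [Pi.sub_apply, Pi.single_eq_same]
      rw [Complex.exp_eq_exp_iff_exists_int]
      exact ⟨-m, by push_cast; ring⟩
    · simp [h]

/-- The special unitary group is divisible. -/
theorem exists_pow_eq_of_mem_specialUnitaryGroup [Nonempty n] {V : Matrix n n ℂ}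
    (hV : V ∈ Matrix.specialUnitaryGroup n ℂ) {k : ℕ} (hk : k ≠ 0) :
    ∃ W ∈ Matrix.specialUnitaryGroup n ℂ, W ^ k = V := by
  obtain ⟨X, hX, htr, rfl⟩ := exists_traceless_skewAdjoint_exp_eq hV
  have hX' : ((k : ℝ)⁻¹ • X) ∈ skewAdjoint (Matrix n n ℂ) := skewAdjoint.smul_mem _ hX
  refine ⟨exp ((k : ℝ)⁻¹ • X), Matrix.mem_specialUnitaryGroup_iff.2
    ⟨exp_mem_unitaryGroup hX', ?_⟩, ?_⟩
  · rw [det_exp_of_skewAdjoint hX', Matrix.trace_smul, htr]; simp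
  · rw [← Matrix.exp_nsmul, ← Nat.cast_smul_eq_nsmul ℝ, smul_smul, mul_inv_cancel₀, one_smul]
    exact_mod_cast hk

end Unitary

/-! ### Transfer of controllability to matrices -/

section MatrixSemigroup

variable {n : Type*} [Fintype n] [DecidableEq n]

/-- A submonoid of matrices containing the forward flows of a family that generates the Lie algebra
of the unitary group contains the unitary group. -/
theorem unitaryGroup_le_of_generates (𝒜 : Set (Matrix n n ℂ))
    (h𝒜 : 𝒜 ⊆ skewAdjoint (Matrix n n ℂ))
    (hgen : ∀ W : Submodule ℝ (Matrix n n ℂ), 𝒜 ⊆ W → (∀ x ∈ W, ∀ y ∈ W, x * y - y * x ∈ W) →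
      ∀ x ∈ skewAdjoint (Matrix n n ℂ), x ∈ W)
    (S : Submonoid (Matrix n n ℂ)) (hS : ∀ a ∈ 𝒜, ∀ t : ℝ, 0 ≤ t → exp (t • a) ∈ S) :
    Matrix.unitaryGroup n ℂ ≤ S := by
  intro V hV
  obtain ⟨X, hX, rfl⟩ := exists_skewAdjoint_exp_eq hV
  open scoped Matrix.Norms.L2Operator in
  have h := exp_mem_flowSemigroup_of_generates h𝒜 hgen hX
  refine (Submonoid.closure_le.2 ?_ : flowSemigroup 𝒜 ≤ S) h
  rintro _ ⟨a, ha, t, ht, rfl⟩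
  exact hS a ha t ht

end MatrixSemigroup

end KerrControl

end

noncomputable section

namespace KerrControl

/-! ### Lie algebras generated by nearest-neighbour couplings -/

section LieAlgebra

variable {r : ℕ}

/-- `i (|k+1⟩⟨k| + |k⟩⟨k+1|)` -/
def ladderX (k : Fin r) : Matrix (Fin (r + 1)) (Fin (r + 1)) ℂ :=
  Complex.I • (Matrix.single k.succ k.castSucc 1 + Matrix.single k.castSucc k.succ 1)

/-- `|k+1⟩⟨k| - |k⟩⟨k+1|` -/
def ladderY (k : Fin r) : Matrix (Fin (r + 1)) (Fin (r + 1)) ℂ :=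
  Matrix.single k.succ k.castSucc 1 - Matrix.single k.castSucc k.succ 1

/-- `i ∑ z_k |k⟩⟨k|` -/
def imagDiagonal (z : Fin (r + 1) → ℝ) : Matrix (Fin (r + 1)) (Fin (r + 1)) ℂ :=
  Complex.I • Matrix.diagonal fun k => (z k : ℂ)

theorem imagDiagonal_commutator_single (z : Fin (r + 1) → ℝ) (i j : Fin (r + 1)) :
    imagDiagonal z * Matrix.single i j 1 - Matrix.single i j 1 * imagDiagonal z =
      (Complex.I * (z i - z j : ℝ)) • Matrix.single i j (1 : ℂ) := by
  ext a b
  simp only [imagDiagonal, smul_mul_assoc, mul_smul_comm, Matrix.sub_apply, Matrix.smul_apply,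
    Matrix.diagonal_mul, Matrix.mul_diagonal, Matrix.single_apply, smul_eq_mul]
  by_cases h : i = a ∧ j = b
  · simp [h, mul_sub]
  · simp [h]

theorem imagDiagonal_commutator_ladderX (z : Fin (r + 1) → ℝ) (k : Fin r) :
    imagDiagonal z * ladderX k - ladderX k * imagDiagonal z =
      (-(z k.succ - z k.castSucc)) • ladderY k := by
  have h1 := imagDiagonal_commutator_single z k.succ k.castSucc
  have h2 := imagDiagonal_commutator_single z k.castSucc k.succ
  have h3 : imagDiagonal z * ladderX k - ladderX k * imagDiagonal z = Complex.I •
      ((imagDiagonal z * Matrix.single k.succ k.castSucc 1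
          - Matrix.single k.succ k.castSucc 1 * imagDiagonal z)
        + (imagDiagonal z * Matrix.single k.castSucc k.succ 1
          - Matrix.single k.castSucc k.succ 1 * imagDiagonal z)) := by
    simp only [ladderX, mul_smul_comm, smul_mul_assoc, mul_add, add_mul, smul_add, smul_sub]
    abel
  rw [h3, h1, h2, ladderY, smul_add, smul_smul, smul_smul, ← mul_assoc, ← mul_assoc,
    Complex.I_mul_I, ← Complex.coe_smul]
  push_cast
  module

theorem imagDiagonal_commutator_ladderY (z : Fin (r + 1) → ℝ) (k : Fin r) :
    imagDiagonal z * ladderY k - ladderY k * imagDiagonal z =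
      (z k.succ - z k.castSucc) • ladderX k := by
  have h1 := imagDiagonal_commutator_single z k.succ k.castSucc
  have h2 := imagDiagonal_commutator_single z k.castSucc k.succ
  have h3 : imagDiagonal z * ladderY k - ladderY k * imagDiagonal z =
      ((imagDiagonal z * Matrix.single k.succ k.castSucc 1
          - Matrix.single k.succ k.castSucc 1 * imagDiagonal z)
        - (imagDiagonal z * Matrix.single k.castSucc k.succ 1
          - Matrix.single k.castSucc k.succ 1 * imagDiagonal z)) := by
    simp only [ladderY, mul_sub, sub_mul]
    abel
  rw [h3, h1, h2, ladderX, ← Complex.coe_smul]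
  push_cast
  module

theorem ladderX_commutator_ladderY (k : Fin r) :
    ladderX k * ladderY k - ladderY k * ladderX k =
      (2 : ℝ) • imagDiagonal (Pi.single k.castSucc 1 - Pi.single k.succ 1) := by
  have hne : k.castSucc ≠ k.succ := k.castSucc_lt_succ.ne
  have hd : imagDiagonal (Pi.single k.castSucc 1 - Pi.single k.succ 1) =
      Complex.I • (Matrix.single k.castSucc k.castSucc 1 - Matrix.single k.succ k.succ (1 : ℂ)) := by
    rw [imagDiagonal, ← Matrix.diagonal_single, ← Matrix.diagonal_single, Matrix.diagonal_sub]
    congr 2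
    ext i
    simp only [Pi.sub_apply, Pi.single_apply]
    split_ifs <;> simp
  rw [hd, ladderX, ladderY, ← Complex.coe_smul]
  simp only [mul_sub, sub_mul, mul_add, add_mul, smul_mul_assoc, mul_smul_comm,
    Matrix.single_mul_single_same, Matrix.single_mul_single_of_ne _ _ _ _ hne,
    Matrix.single_mul_single_of_ne _ _ _ _ hne.symm, mul_one]
  push_cast
  module

variable {W : Submodule ℝ (Matrix (Fin (r + 1)) (Fin (r + 1)) ℂ)}

theorem sum_ladderY_mem (hW : ∀ x ∈ W, ∀ y ∈ W, x * y - y * x ∈ W) {z : Fin (r + 1) → ℝ}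
    (hz : imagDiagonal z ∈ W) {c : Fin r → ℝ} (hc : ∑ k, c k • ladderX k ∈ W) :
    ∑ k : Fin r, (c k * (z k.succ - z k.castSucc)) • ladderY k ∈ W := by
  have h := W.neg_mem (hW _ hz _ hc)
  rw [Finset.mul_sum, Finset.sum_mul, ← Finset.sum_sub_distrib, ← Finset.sum_neg_distrib] at h
  convert h using 2 with k
  rw [mul_smul_comm, smul_mul_assoc, ← smul_sub, imagDiagonal_commutator_ladderX, smul_smul,
    ← neg_smul]
  congr 1
  ring

theorem sum_ladderX_mem (hW : ∀ x ∈ W, ∀ y ∈ W, x * y - y * x ∈ W) {z : Fin (r + 1) → ℝ}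
    (hz : imagDiagonal z ∈ W) {c : Fin r → ℝ} (hc : ∑ k, c k • ladderY k ∈ W) :
    ∑ k : Fin r, (c k * (z k.succ - z k.castSucc)) • ladderX k ∈ W := by
  have h := hW _ hz _ hc
  rw [Finset.mul_sum, Finset.sum_mul, ← Finset.sum_sub_distrib] at h
  convert h using 2 with k
  rw [mul_smul_comm, smul_mul_assoc, ← smul_sub, imagDiagonal_commutator_ladderY, smul_smul]

/-- A coupling whose squared gap differs from all others, and is nonzero, can be isolated. -/
theorem ladder_mem_of_isolated (hW : ∀ x ∈ W, ∀ y ∈ W, x * y - y * x ∈ W) {z : Fin (r + 1) → ℝ}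
    (hz : imagDiagonal z ∈ W) {d : Fin r → ℝ} (hd : ∑ k, d k • ladderX k ∈ W)
    {k₀ : Fin r} (hdk : d k₀ ≠ 0) (hzk : z k₀.succ - z k₀.castSucc ≠ 0)
    (hiso : ∀ j ≠ k₀, (z j.succ - z j.castSucc) ^ 2 ≠ (z k₀.succ - z k₀.castSucc) ^ 2) :
    ladderX k₀ ∈ W ∧ ladderY k₀ ∈ W := by
  -- Two commutators with the diagonal element multiply `ladderX k` by minus its squared gap. Hence
  -- polynomials in the squared gaps can be applied to the coefficients; the one vanishing at every
  -- index other than `k₀` leaves a single term.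
  have key : ∀ s : Finset (Fin r), ∑ k : Fin r, (d k * ∏ j ∈ s,
      ((z j.succ - z j.castSucc) ^ 2 - (z k.succ - z k.castSucc) ^ 2)) • ladderX k ∈ W := by
    intro s
    induction s using Finset.induction_on with
    | empty => simpa using hd
    | insert a s ha ih =>
      have h1 := sum_ladderX_mem hW hz (sum_ladderY_mem hW hz ih)
      have h2 := W.sub_mem (W.smul_mem ((z a.succ - z a.castSucc) ^ 2) ih) h1
      rw [Finset.smul_sum, ← Finset.sum_sub_distrib] at h2
      convert h2 using 2 with k
      rw [smul_smul, ← sub_smul, Finset.prod_insert ha]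
      congr 1
      ring
  have h := key (Finset.univ.erase k₀)
  rw [Finset.sum_eq_single k₀] at h
  · have hne : d k₀ * ∏ j ∈ Finset.univ.erase k₀,
        ((z j.succ - z j.castSucc) ^ 2 - (z k₀.succ - z k₀.castSucc) ^ 2) ≠ 0 :=
      mul_ne_zero hdk (Finset.prod_ne_zero_iff.2 fun j hj =>
        sub_ne_zero.2 (hiso j (Finset.ne_of_mem_erase hj)))
    have hX : ladderX k₀ ∈ W := (W.smul_mem_iff hne).1 h
    refine ⟨hX, ?_⟩
    have h2 := hW _ hz _ hX
    rw [imagDiagonal_commutator_ladderX] at h2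
    exact (W.smul_mem_iff (neg_ne_zero.2 hzk)).1 h2
  · intro b _ hb
    rw [Finset.prod_eq_zero (Finset.mem_erase.2 ⟨hb, Finset.mem_univ b⟩) (sub_self _)]
    simp
  · simp

/-- If all couplings but one that `z` detects are available, then so is the remaining one. -/
theorem ladder_mem_of_detected (hW : ∀ x ∈ W, ∀ y ∈ W, x * y - y * x ∈ W) {z : Fin (r + 1) → ℝ}
    (hz : imagDiagonal z ∈ W) {d : Fin r → ℝ} (hd : ∑ k, d k • ladderX k ∈ W)
    {k₀ : Fin r} (hdk : d k₀ ≠ 0) (hzk : z k₀.succ - z k₀.castSucc ≠ 0)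
    (hother : ∀ l ≠ k₀, z l.succ - z l.castSucc ≠ 0 → ladderY l ∈ W) :
    ladderX k₀ ∈ W ∧ ladderY k₀ ∈ W := by
  have h := sum_ladderY_mem hW hz hd
  rw [← Finset.add_sum_erase _ _ (Finset.mem_univ k₀)] at h
  have h1 : ∑ l ∈ Finset.univ.erase k₀, (d l * (z l.succ - z l.castSucc)) • ladderY l ∈ W := by
    refine W.sum_mem fun l hl => ?_
    by_cases h0 : z l.succ - z l.castSucc = 0
    · simp [h0]
    · exact W.smul_mem _ (hother l (Finset.ne_of_mem_erase hl) h0)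
  have hY : ladderY k₀ ∈ W :=
    (W.smul_mem_iff (mul_ne_zero hdk hzk)).1 ((W.add_mem_iff_left h1).1 h)
  refine ⟨?_, hY⟩
  have h2 := hW _ hz _ hY
  rw [imagDiagonal_commutator_ladderY] at h2
  exact (W.smul_mem_iff hzk).1 h2

/-- The commutator of the quadratures of `j` is a diagonal element whose gaps vanish except at `j`
and its neighbours. Once `j` and the neighbour other than `k` are known, `k` alone remains in the
control. -/
theorem ladder_mem_of_adjacent (hW : ∀ x ∈ W, ∀ y ∈ W, x * y - y * x ∈ W)
    {d : Fin r → ℝ} (hd : ∑ k, d k • ladderX k ∈ W) (hd0 : ∀ k, d k ≠ 0) {j k : Fin r}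
    (hj : ladderX j ∈ W ∧ ladderY j ∈ W) (hjk : (j : ℕ) + 1 = k ∨ (k : ℕ) + 1 = j)
    (hother : ∀ l ≠ k, (j : ℕ) + 1 = l ∨ (l : ℕ) + 1 = j → ladderY l ∈ W) :
    ladderX k ∈ W ∧ ladderY k ∈ W := by
  have hz : imagDiagonal (Pi.single j.castSucc 1 - Pi.single j.succ 1) ∈ W := by
    have h := hW _ hj.1 _ hj.2
    rw [ladderX_commutator_ladderY] at h
    exact (W.smul_mem_iff two_ne_zero).1 h
  refine ladder_mem_of_detected hW hz hd (hd0 k) ?_ ?_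
  · rcases hjk with h | h
    · have h1 : k.castSucc = j.succ := by ext; simp; omega
      have h2 : k.succ ≠ j.castSucc := by intro h'; simp [Fin.ext_iff] at h'; omega
      have h3 : k.succ ≠ j.succ := by intro h'; simp [Fin.ext_iff] at h'; omega
      have h4 : j.succ ≠ j.castSucc := j.castSucc_lt_succ.ne'
      simp [h1, h2, h3, h4]
    · have h1 : k.succ = j.castSucc := by ext; simp; omega
      have h2 : k.castSucc ≠ j.castSucc := by intro h'; simp [Fin.ext_iff] at h'; omega
      have h3 : k.castSucc ≠ j.succ := by intro h'; simp [Fin.ext_iff] at h'; omega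
      have h4 : j.castSucc ≠ j.succ := j.castSucc_lt_succ.ne
      simp [h1, h2, h3, h4]
  · intro l hl hne
    by_cases hlj : l = j
    · rw [hlj]; exact hj.2
    refine hother l hl ?_
    by_contra! hcon
    have hlj' : (l : ℕ) ≠ j := fun h => hlj (Fin.ext h)
    refine hne ?_
    have h1 : l.succ ≠ j.castSucc := by intro h'; simp [Fin.ext_iff] at h'; omega
    have h2 : l.castSucc ≠ j.castSucc := by intro h'; simp [Fin.ext_iff] at h'; omega
    have h3 : l.castSucc ≠ j.succ := by intro h'; simp [Fin.ext_iff] at h'; omega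
    have h4 : l.succ ≠ j.succ := by intro h'; simp [Fin.ext_iff] at h'; omega
    simp [h1, h2, h3, h4]

theorem ladder_mem_of_first (hW : ∀ x ∈ W, ∀ y ∈ W, x * y - y * x ∈ W)
    {d : Fin r → ℝ} (hd : ∑ k, d k • ladderX k ∈ W) (hd0 : ∀ k, d k ≠ 0) (hr : 0 < r)
    (h0 : ladderX (⟨0, hr⟩ : Fin r) ∈ W ∧ ladderY (⟨0, hr⟩ : Fin r) ∈ W) (k : Fin r) :
    ladderX k ∈ W ∧ ladderY k ∈ W := by
  obtain ⟨m, hm⟩ := k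
  induction m using Nat.strong_induction_on with
  | _ m ih =>
    rcases m with _ | m
    · exact h0
    · refine ladder_mem_of_adjacent hW hd hd0 (j := ⟨m, by omega⟩) (ih m (by omega) _)
        (Or.inl rfl) fun l hl h => ?_
      have hl' : (l : ℕ) ≠ m + 1 := fun h' => hl (Fin.ext h')
      simp only at h
      exact (ih l (by omega) l.2).2

theorem ladder_mem_of_last (hW : ∀ x ∈ W, ∀ y ∈ W, x * y - y * x ∈ W)
    {d : Fin r → ℝ} (hd : ∑ k, d k • ladderX k ∈ W) (hd0 : ∀ k, d k ≠ 0) (hr : 0 < r)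
    (h0 : ladderX (⟨r - 1, by omega⟩ : Fin r) ∈ W ∧ ladderY (⟨r - 1, by omega⟩ : Fin r) ∈ W)
    (k : Fin r) : ladderX k ∈ W ∧ ladderY k ∈ W := by
  suffices h : ∀ m, ∀ k : Fin r, (k : ℕ) + m + 1 = r → ladderX k ∈ W ∧ ladderY k ∈ W from
    h (r - 1 - k) k (by omega)
  intro m
  induction m using Nat.strong_induction_on with
  | _ m ih =>
    intro k hk
    rcases m with _ | m
    · have : k = ⟨r - 1, by omega⟩ := Fin.ext (by simp; omega)
      rw [this]; exact h0
    · refine ladder_mem_of_adjacent hW hd hd0 (j := ⟨k + 1, by omega⟩)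
        (ih m (by omega) _ (by simp; omega)) (Or.inr rfl) fun l hl h => ?_
      have hl' : (l : ℕ) ≠ k := fun h' => hl (Fin.ext h')
      simp only at h
      exact (ih (r - 1 - l) (by omega) l (by omega)).2

/-- The elementary matrices next to the diagonal generate all traceless matrices. -/
theorem mem_of_trace_eq_zero {Z : Submodule ℂ (Matrix (Fin (r + 1)) (Fin (r + 1)) ℂ)}
    (hZ : ∀ x ∈ Z, ∀ y ∈ Z, x * y - y * x ∈ Z)
    (hE : ∀ k : Fin r, Matrix.single k.succ k.castSucc 1 ∈ Z ∧
      Matrix.single k.castSucc k.succ 1 ∈ Z)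
    {x : Matrix (Fin (r + 1)) (Fin (r + 1)) ℂ} (hx : x.trace = 0) : x ∈ Z := by
  have hoff : ∀ m : ℕ, ∀ i j : Fin (r + 1), (j : ℕ) = i + m + 1 →
      Matrix.single i j 1 ∈ Z ∧ Matrix.single j i 1 ∈ Z := by
    intro m
    induction m with
    | zero =>
      intro i j hij
      have h := hE ⟨i, by omega⟩
      have h1 : (⟨i, by omega⟩ : Fin r).castSucc = i := rfl
      have h2 : (⟨i, by omega⟩ : Fin r).succ = j := Fin.ext (by simp [hij])
      rw [h1, h2] at h
      exact ⟨h.2, h.1⟩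
    | succ m ih =>
      intro i j hij
      obtain ⟨h1, h2⟩ := ih i ⟨i + m + 1, by omega⟩ rfl
      have hne : i ≠ j := fun h => by rw [h] at hij; omega
      obtain ⟨h3, h4⟩ : Matrix.single (⟨i + m + 1, by omega⟩ : Fin (r + 1)) j 1 ∈ Z ∧
          Matrix.single j (⟨i + m + 1, by omega⟩ : Fin (r + 1)) 1 ∈ Z := by
        have h := hE ⟨i + m + 1, by omega⟩
        have h1 : (⟨i + m + 1, by omega⟩ : Fin r).castSucc = ⟨i + m + 1, by omega⟩ := rfl
        have h2 : (⟨i + m + 1, by omega⟩ : Fin r).succ = j := Fin.ext (by simp [hij]; omega)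
        rw [h1, h2] at h
        exact ⟨h.2, h.1⟩
      constructor
      · have := hZ _ h1 _ h3
        rwa [Matrix.single_mul_single_same, Matrix.single_mul_single_of_ne _ _ _ _ hne.symm,
          sub_zero, one_mul] at this
      · have := hZ _ h4 _ h2
        rwa [Matrix.single_mul_single_same, Matrix.single_mul_single_of_ne _ _ _ _ hne,
          sub_zero, one_mul] at this
  have hoff' : ∀ i j : Fin (r + 1), i ≠ j → Matrix.single i j 1 ∈ Z := by
    intro i j hij
    rcases lt_or_gt_of_ne (Fin.val_ne_of_ne hij) with h | h
    · exact (hoff (j - i - 1) i j (by omega)).1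
    · exact (hoff (i - j - 1) j i (by omega)).2
  have hdiag : ∀ i : Fin (r + 1), Matrix.single i i 1 - Matrix.single 0 0 1 ∈ Z := by
    intro i
    rcases eq_or_ne i 0 with rfl | h
    · simp
    · have := hZ _ (hoff' i 0 h) _ (hoff' 0 i h.symm)
      rwa [Matrix.single_mul_single_same, Matrix.single_mul_single_same, one_mul] at this
  -- The subtracted terms add up to the trace of `x` in the corner entry, which is zero.
  have hsum : x = ∑ i, ∑ j, x i j • (Matrix.single i j 1
      - if i = j then Matrix.single 0 0 (1 : ℂ) else 0) := by
    simp only [smul_sub, Finset.sum_sub_distrib, smul_ite, smul_zero, Finset.sum_ite_eq,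
      Finset.mem_univ, if_true, Matrix.smul_single, smul_eq_mul, mul_one]
    rw [← Matrix.matrix_eq_sum_single]
    have : ∑ i, Matrix.single (0 : Fin (r + 1)) (0 : Fin (r + 1)) (x i i) = 0 := by
      have h := congrArg (Matrix.single (0 : Fin (r + 1)) (0 : Fin (r + 1))) hx
      rw [Matrix.trace, Matrix.single_zero] at h
      rw [← h]
      exact (map_sum (Matrix.singleAddMonoidHom (0 : Fin (r + 1)) (0 : Fin (r + 1)))
        (fun i => x i i) Finset.univ).symm
    rw [this, sub_zero]
  rw [hsum]
  refine Z.sum_mem fun i _ => Z.sum_mem fun j _ => Z.smul_mem _ ?_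
  by_cases h : i = j
  · subst h; simpa using hdiag i
  · simpa [h] using hoff' i j h

/-- The complexification `Z` of the skew-adjoint part of `W` contains the elementary matrices next
to the diagonal, hence all traceless matrices. In `x = a + i b` the term `i b` is self-adjoint, so
it vanishes when `x` is skew-adjoint. -/
theorem traceless_mem_of_ladder_mem (hW : ∀ x ∈ W, ∀ y ∈ W, x * y - y * x ∈ W)
    (hl : ∀ k : Fin r, ladderX k ∈ W ∧ ladderY k ∈ W)
    {x : Matrix (Fin (r + 1)) (Fin (r + 1)) ℂ} (hx : x ∈ skewAdjoint _) (htr : x.trace = 0) :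
    x ∈ W := by
  let Z : Submodule ℂ (Matrix (Fin (r + 1)) (Fin (r + 1)) ℂ) :=
    { carrier := {y | ∃ a ∈ W, ∃ b ∈ W, star a = -a ∧ star b = -b ∧ y = a + Complex.I • b}
      add_mem' := by
        rintro _ _ ⟨a, ha, b, hb, ha', hb', rfl⟩ ⟨c, hc, d, hd, hc', hd', rfl⟩
        refine ⟨a + c, W.add_mem ha hc, b + d, W.add_mem hb hd, ?_, ?_, ?_⟩
        · rw [star_add, ha', hc']; abel
        · rw [star_add, hb', hd']; abel
        · rw [smul_add]; abel
      zero_mem' := ⟨0, W.zero_mem, 0, W.zero_mem, by simp, by simp, by simp⟩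
      smul_mem' := by
        rintro c _ ⟨a, ha, b, hb, ha', hb', rfl⟩
        refine ⟨c.re • a - c.im • b, W.sub_mem (W.smul_mem _ ha) (W.smul_mem _ hb),
          c.re • b + c.im • a, W.add_mem (W.smul_mem _ hb) (W.smul_mem _ ha), ?_, ?_, ?_⟩
        · rw [star_sub, star_smul, star_smul, ha', hb']; simp; abel
        · rw [star_add, star_smul, star_smul, ha', hb']; simp; abel
        · conv_lhs => rw [← Complex.re_add_im c]
          ext i j
          simp only [Matrix.smul_apply, Matrix.add_apply, Matrix.sub_apply, smul_eq_mul,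
            Complex.real_smul]
          linear_combination (c.im : ℂ) * b i j * Complex.I_mul_I }
  have hZ : ∀ x ∈ Z, ∀ y ∈ Z, x * y - y * x ∈ Z := by
    have hstar : ∀ {a b : Matrix (Fin (r + 1)) (Fin (r + 1)) ℂ}, star a = -a → star b = -b →
        star (a * b - b * a) = -(a * b - b * a) := by
      intro a b ha hb
      rw [star_sub, star_mul, star_mul, ha, hb]; noncomm_ring
    rintro _ ⟨a, ha, b, hb, ha', hb', rfl⟩ _ ⟨c, hc, d, hd, hc', hd', rfl⟩
    refine ⟨(a * c - c * a) - (b * d - d * b), W.sub_mem (hW a ha c hc) (hW b hb d hd),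
      (a * d - d * a) + (b * c - c * b), W.add_mem (hW a ha d hd) (hW b hb c hc), ?_, ?_, ?_⟩
    · rw [star_sub, hstar ha' hc', hstar hb' hd']; abel
    · rw [star_add, hstar ha' hd', hstar hb' hc']; abel
    · simp only [mul_add, add_mul, smul_mul_assoc, mul_smul_comm, smul_smul, Complex.I_mul_I,
        neg_smul, one_smul, smul_add, smul_sub]
      abel
  have hX : ∀ k : Fin r, star (ladderX k) = -ladderX k := fun k => by
    rw [ladderX, star_smul, star_add]
    simp [Matrix.star_eq_conjTranspose, Matrix.conjTranspose_single, add_comm,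
      -Matrix.smul_single, -smul_add]
  have hY : ∀ k : Fin r, star (ladderY k) = -ladderY k := fun k => by
    simp [ladderY, Matrix.star_eq_conjTranspose, Matrix.conjTranspose_single]
  have hII : ∀ y : Matrix (Fin (r + 1)) (Fin (r + 1)) ℂ, Complex.I • Complex.I • y = -y := by
    intro y; rw [smul_smul, Complex.I_mul_I, neg_one_smul]
  have hmem : x ∈ Z := by
    refine mem_of_trace_eq_zero hZ (fun k => ⟨?_, ?_⟩) htr
    · refine ⟨(2⁻¹ : ℝ) • ladderY k, W.smul_mem _ (hl k).2, (-2⁻¹ : ℝ) • ladderX k,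
        W.smul_mem _ (hl k).1, by rw [star_smul, hY]; simp, by rw [star_smul, hX]; simp, ?_⟩
      rw [ladderX, smul_comm Complex.I, hII, ladderY]
      module
    · refine ⟨(-2⁻¹ : ℝ) • ladderY k, W.smul_mem _ (hl k).2, (-2⁻¹ : ℝ) • ladderX k,
        W.smul_mem _ (hl k).1, by rw [star_smul, hY]; simp, by rw [star_smul, hX]; simp, ?_⟩
      rw [ladderX, smul_comm Complex.I, hII, ladderY]
      module
  obtain ⟨a, ha, b, hb, ha', hb', rfl⟩ := hmem
  rw [skewAdjoint.mem_iff, star_add, star_smul, ha', hb'] at hx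
  have h0 : Complex.I • b = 0 := by
    have h1 : Complex.I • b + Complex.I • b = 0 := by
      have : star Complex.I • -b = Complex.I • b := by simp
      rw [this] at hx
      have h2 := congrArg (fun y => y + a + Complex.I • b) hx
      calc Complex.I • b + Complex.I • b = -a + Complex.I • b + a + Complex.I • b := by abel
        _ = _ := h2
        _ = 0 := by abel
    rw [← two_smul ℂ] at h1
    exact (smul_eq_zero.1 h1).resolve_left two_ne_zero
  rw [h0, add_zero]
  exact ha

end LieAlgebra

/-! ### The Kerr spectrum and the resonance condition -/

section Kerr

/-- The energies `E_k` of the drift. -/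
def energy (χ Δ₀ : ℝ) (r : ℕ) (k : Fin (r + 1)) : ℝ :=
  χ * (((k : ℕ) : ℝ) ^ 2 - ((k : ℕ) : ℝ)) / 2 + Δ₀ * ((k : ℕ) : ℝ)

theorem I_smul_drift (χ Δ₀ : ℝ) (r : ℕ) :
    Complex.I • drift χ Δ₀ r = imagDiagonal (energy χ Δ₀ r) := rfl

theorem I_smul_controlRe (r : ℕ) :
    Complex.I • controlRe r = ∑ k, coupling r k • ladderX k := by
  rw [controlRe, Finset.smul_sum]
  refine Finset.sum_congr rfl fun k _ => ?_
  rw [ladderX, smul_comm, Complex.coe_smul]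

theorem energy_gap (χ Δ₀ : ℝ) (r : ℕ) (k : Fin r) :
    energy χ Δ₀ r k.succ - energy χ Δ₀ r k.castSucc = χ * ((k : ℕ) : ℝ) + Δ₀ := by
  simp [energy]; ring

theorem coupling_ne_zero (r : ℕ) (k : Fin r) : coupling r k ≠ 0 := by
  have h : ((k : ℕ) : ℝ) < r := by exact_mod_cast k.2
  exact mul_ne_zero (sub_ne_zero.2 h.ne) (Real.sqrt_ne_zero'.2 (by positivity))

theorem ladder_mem_of_drift_control_mem {χ Δ₀ : ℝ} {r : ℕ} (hχ : χ ≠ 0)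
    (hr : (r : ℝ) ≠ 1 - 2 * Δ₀ / χ) {W : Submodule ℝ (Matrix (Fin (r + 1)) (Fin (r + 1)) ℂ)}
    (hW : ∀ x ∈ W, ∀ y ∈ W, x * y - y * x ∈ W) (hd : Complex.I • drift χ Δ₀ r ∈ W)
    (hc : Complex.I • controlRe r ∈ W) (k : Fin r) : ladderX k ∈ W ∧ ladderY k ∈ W := by
  have hr0 : 0 < r := k.pos
  rw [I_smul_drift] at hd
  rw [I_smul_controlRe] at hc
  -- Since `Δ₀ = -χ m / 2`, a difference of squared gaps factors as `χ² (j - l) (j + l - m)`. Sums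
  -- involving the last index are at least `r - 1`, those involving the first at most `r - 1`, so `m
  -- ≠ r - 1` leaves one end without coincidences.
  set m : ℝ := -2 * Δ₀ / χ with hm
  have hΔ : Δ₀ = -(χ * m) / 2 := by rw [hm]; field_simp
  have hmr : m ≠ r - 1 := by
    intro h; apply hr
    have : 2 * Δ₀ / χ = -m := by rw [hm]; ring
    rw [this, h]; ring
  have hiso : ∀ j l : Fin r, j ≠ l → ((j : ℕ) : ℝ) + (l : ℕ) ≠ m →
      (χ * ((j : ℕ) : ℝ) + Δ₀) ^ 2 ≠ (χ * ((l : ℕ) : ℝ) + Δ₀) ^ 2 := by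
    intro j l hjl hsum h
    have h1 : χ ^ 2 * ((((j : ℕ) : ℝ) - (l : ℕ)) * (((j : ℕ) : ℝ) + (l : ℕ) - m)) = 0 := by
      rw [hΔ] at h; linear_combination h
    have h2 : (((j : ℕ) : ℝ) - (l : ℕ)) ≠ 0 :=
      sub_ne_zero.2 fun h' => hjl (Fin.ext (by exact_mod_cast h'))
    exact mul_ne_zero (pow_ne_zero 2 hχ) (mul_ne_zero h2 (sub_ne_zero.2 hsum)) h1
  have hgap : ∀ l : Fin r, 2 * ((l : ℕ) : ℝ) ≠ m → χ * ((l : ℕ) : ℝ) + Δ₀ ≠ 0 := by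
    intro l hl h
    have h1 : χ * (2 * ((l : ℕ) : ℝ) - m) = 0 := by rw [hΔ] at h; linear_combination 2 * h
    exact mul_ne_zero hχ (sub_ne_zero.2 hl) h1
  have hr1 : (1 : ℝ) ≤ r := by exact_mod_cast hr0
  rcases lt_or_gt_of_ne hmr with hlt | hgt
  · have hcast : (((r - 1 : ℕ) : ℕ) : ℝ) = r - 1 := by
      rw [Nat.cast_sub hr0, Nat.cast_one]
    refine ladder_mem_of_last hW hc (coupling_ne_zero r) hr0 ?_ k
    refine ladder_mem_of_isolated hW hd hc (coupling_ne_zero r _) ?_ fun j hj => ?_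
    · rw [energy_gap]
      exact hgap _ (by simp only [hcast]; linarith)
    · rw [energy_gap, energy_gap]
      have : (0 : ℝ) ≤ ((j : ℕ) : ℝ) := by positivity
      exact hiso _ _ hj (by simp only [hcast]; linarith)
  · refine ladder_mem_of_first hW hc (coupling_ne_zero r) hr0 ?_ k
    refine ladder_mem_of_isolated hW hd hc (coupling_ne_zero r _) ?_ fun j hj => ?_
    · rw [energy_gap]
      exact hgap _ (by simp; linarith)
    · rw [energy_gap, energy_gap]
      have : ((j : ℕ) : ℝ) ≤ r - 1 := by
        have : (j : ℕ) + 1 ≤ r := j.2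
        have : ((j : ℕ) : ℝ) + 1 ≤ r := by exact_mod_cast this
        linarith
      exact hiso _ _ hj (by simp; linarith)

theorem traceless_mem {χ Δ₀ : ℝ} {r : ℕ} (hχ : χ ≠ 0)
    (hr : (r : ℝ) ≠ 1 - 2 * Δ₀ / χ) {W : Submodule ℝ (Matrix (Fin (r + 1)) (Fin (r + 1)) ℂ)}
    (hW : ∀ x ∈ W, ∀ y ∈ W, x * y - y * x ∈ W) (hd : Complex.I • drift χ Δ₀ r ∈ W)
    (hc : Complex.I • controlRe r ∈ W) {x : Matrix (Fin (r + 1)) (Fin (r + 1)) ℂ}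
    (hx : x ∈ skewAdjoint _) (htr : x.trace = 0) : x ∈ W :=
  traceless_mem_of_ladder_mem hW (ladder_mem_of_drift_control_mem hχ hr hW hd hc) hx htr

/-- Traces of skew-adjoint matrices are purely imaginary, so the traceless ones have real
codimension one and a real multiple of `y` corrects the trace. -/
theorem skewAdjoint_mem_of_trace_ne_zero {r : ℕ}
    {W : Submodule ℝ (Matrix (Fin (r + 1)) (Fin (r + 1)) ℂ)}
    (hW : ∀ x ∈ skewAdjoint (Matrix (Fin (r + 1)) (Fin (r + 1)) ℂ), x.trace = 0 → x ∈ W)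
    {y : Matrix (Fin (r + 1)) (Fin (r + 1)) ℂ} (hy : y ∈ skewAdjoint _) (hyW : y ∈ W)
    (hytr : y.trace ≠ 0) {x : Matrix (Fin (r + 1)) (Fin (r + 1)) ℂ} (hx : x ∈ skewAdjoint _) :
    x ∈ W := by
  have him : ∀ z : Matrix (Fin (r + 1)) (Fin (r + 1)) ℂ, z ∈ skewAdjoint _ →
      z.trace = Complex.I * (z.trace.im : ℝ) := by
    intro z hz
    have h := congrArg Matrix.trace (skewAdjoint.mem_iff.1 hz)
    rw [Matrix.star_eq_conjTranspose, Matrix.trace_conjTranspose, Matrix.trace_neg] at h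
    have hre := congrArg Complex.re h
    simp only [Complex.star_def, Complex.conj_re, Complex.neg_re] at hre
    apply Complex.ext
    · simp; linarith
    · simp
  have hy0 : y.trace.im ≠ 0 := fun h => hytr (by rw [him y hy, h]; simp)
  have h := hW (x - (x.trace.im / y.trace.im) • y)
    (sub_mem hx (skewAdjoint.smul_mem _ hy)) (by
      rw [Matrix.trace_sub, Matrix.trace_smul, him x hx, him y hy, Complex.real_smul]
      have : (y.trace.im : ℂ) ≠ 0 := by exact_mod_cast hy0
      simp
      field_simp
      ring)
  have h2 := W.add_mem h (W.smul_mem (x.trace.im / y.trace.im) hyW)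
  rwa [sub_add_cancel] at h2

end Kerr

end KerrControl

end

noncomputable section

namespace KerrControl

open NormedSpace

/-! ### The drive Hamiltonian in the Fock basis -/

section Blockade

theorem annihilation_single (n : ℕ) :
    annihilation (Finsupp.single n 1) = (Real.sqrt n : ℂ) • Finsupp.single (n - 1) 1 := by
  simp [annihilation]

theorem creation_single (n : ℕ) :
    creation (Finsupp.single n 1) = (Real.sqrt (n + 1) : ℂ) • Finsupp.single (n + 1) 1 := by
  simp [creation]

theorem number_single (n : ℕ) :
    number (Finsupp.single n 1) = (n : ℂ) • Finsupp.single n 1 := by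
  rw [number, Module.End.mul_apply, annihilation_single, map_smul, creation_single, smul_smul]
  rcases n with _ | n
  · simp
  · have h : Real.sqrt ((n + 1 : ℕ) : ℝ) * Real.sqrt ((n : ℝ) + 1) = (n : ℝ) + 1 := by
      rw [Nat.cast_succ, Real.mul_self_sqrt (by positivity)]
    rw [Nat.add_sub_cancel, ← Complex.ofReal_mul, h]
    push_cast
    rfl

theorem creation_sq_annihilation_sq_single (n : ℕ) :
    (creation ^ 2 * annihilation ^ 2) (Finsupp.single n 1) =
      ((n : ℂ) ^ 2 - n) • Finsupp.single n 1 := by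
  have h : creation ^ 2 * annihilation ^ 2 = creation * number * annihilation := by
    rw [number]; noncomm_ring
  rw [h, Module.End.mul_apply, Module.End.mul_apply, annihilation_single, map_smul, number_single,
    map_smul, map_smul, smul_comm, ← map_smul, ← annihilation_single, ← Module.End.mul_apply,
    ← number, number_single, smul_smul]
  rcases n with _ | n
  · simp
  · congr 1
    rw [Nat.add_sub_cancel]
    push_cast
    ring

theorem driveHamiltonian_single (χ Δ₀ : ℝ) (r : ℕ) (α : ℂ) (n : ℕ) :
    driveHamiltonian χ Δ₀ r α (Finsupp.single n 1) =
      (((χ * ((n : ℝ) ^ 2 - n) / 2 + Δ₀ * n : ℝ)) : ℂ) • Finsupp.single n 1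
      + (χ * α * ((((n : ℝ) - r) * Real.sqrt (n + 1) : ℝ) : ℂ)) • Finsupp.single (n + 1) 1
      + (χ * star α * (((((n - 1 : ℕ) : ℝ) - r) * Real.sqrt n : ℝ) : ℂ))
        • Finsupp.single (n - 1) 1 := by
  simp only [driveHamiltonian, LinearMap.add_apply, LinearMap.smul_apply, LinearMap.sub_apply,
    Module.End.mul_apply (creation) (number - _), Module.End.mul_apply (number - _) annihilation,
    creation_sq_annihilation_sq_single, number_single, annihilation_single, creation_single,
    map_smul, map_sub, Module.End.one_apply]
  push_cast
  module

theorem sum_smul_single_succ_apply {r : ℕ} (f : ℕ → ℂ) (m n : Fin (r + 1)) :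
    (∑ k : Fin r, f k • Matrix.single k.succ k.castSucc (1 : ℂ)) m n =
      if (m : ℕ) = n + 1 then f n else 0 := by
  rw [Matrix.sum_apply]
  split_ifs with h
  · rw [Finset.sum_eq_single (⟨n, by omega⟩ : Fin r)]
    · have h1 : (⟨n, by omega⟩ : Fin r).succ = m := Fin.ext (by simp [h])
      have h2 : (⟨n, by omega⟩ : Fin r).castSucc = n := rfl
      rw [h1, h2]
      simp
    · intro b _ hb
      have : b.castSucc ≠ n := fun h' => hb (Fin.ext (by simpa using congrArg Fin.val h'))
      simp [this]
    · simp
  · refine Finset.sum_eq_zero fun k _ => ?_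
    have : ¬ (k.succ = m ∧ k.castSucc = n) := by
      rintro ⟨rfl, rfl⟩
      simp at h
    simp [this]

theorem sum_smul_single_castSucc_apply {r : ℕ} (f : ℕ → ℂ) (m n : Fin (r + 1)) :
    (∑ k : Fin r, f k • Matrix.single k.castSucc k.succ (1 : ℂ)) m n =
      if (n : ℕ) = m + 1 then f m else 0 := by
  rw [← sum_smul_single_succ_apply f n m, Matrix.sum_apply, Matrix.sum_apply]
  refine Finset.sum_congr rfl fun k _ => ?_
  simp [Matrix.single_apply, and_comm]

theorem controlRe_apply (r : ℕ) (m n : Fin (r + 1)) :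
    controlRe r m n =
      (if (m : ℕ) = n + 1 then
        (((((n : ℕ) : ℝ) - r) * Real.sqrt ((n : ℕ) + 1) : ℝ) : ℂ) else 0)
      + if (n : ℕ) = m + 1 then
        (((((m : ℕ) : ℝ) - r) * Real.sqrt ((m : ℕ) + 1) : ℝ) : ℂ) else 0 := by
  have h1 := sum_smul_single_succ_apply
    (fun k => ((((k : ℝ) - r) * Real.sqrt ((k : ℝ) + 1) : ℝ) : ℂ)) m n
  have h2 := sum_smul_single_castSucc_apply
    (fun k => ((((k : ℝ) - r) * Real.sqrt ((k : ℝ) + 1) : ℝ) : ℂ)) m n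
  rw [← h1, ← h2, ← Matrix.add_apply, ← Finset.sum_add_distrib]
  simp only [controlRe, coupling, smul_add]

theorem controlIm_apply (r : ℕ) (m n : Fin (r + 1)) :
    controlIm r m n = Complex.I *
      ((if (m : ℕ) = n + 1 then
        (((((n : ℕ) : ℝ) - r) * Real.sqrt ((n : ℕ) + 1) : ℝ) : ℂ) else 0)
      - if (n : ℕ) = m + 1 then
        (((((m : ℕ) : ℝ) - r) * Real.sqrt ((m : ℕ) + 1) : ℝ) : ℂ) else 0) := by
  have h1 := sum_smul_single_succ_apply
    (fun k => ((((k : ℝ) - r) * Real.sqrt ((k : ℝ) + 1) : ℝ) : ℂ)) m n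
  have h2 := sum_smul_single_castSucc_apply
    (fun k => ((((k : ℝ) - r) * Real.sqrt ((k : ℝ) + 1) : ℝ) : ℂ)) m n
  rw [← h1, ← h2, ← Matrix.sub_apply, ← Finset.sum_sub_distrib, ← smul_eq_mul,
    ← Matrix.smul_apply, Finset.smul_sum]
  simp only [controlIm, coupling, smul_sub, mul_smul]

theorem blockade_driveHamiltonian (χ Δ₀ : ℝ) (r : ℕ) (α : ℂ) :
    blockade r (driveHamiltonian χ Δ₀ r α) =
      drift χ Δ₀ r + ((χ * α.re : ℝ) : ℂ) • controlRe r
        + ((χ * α.im : ℝ) : ℂ) • controlIm r := by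
  ext m n
  obtain ⟨m, hm⟩ := m
  obtain ⟨n, hn⟩ := n
  simp only [blockade, Matrix.of_apply, driveHamiltonian_single, Matrix.add_apply,
    Matrix.smul_apply, controlRe_apply, controlIm_apply, drift, Matrix.diagonal_apply,
    Finsupp.add_apply, Finsupp.smul_apply, Finsupp.single_apply, smul_eq_mul, Fin.mk.injEq]
  have hα : α = α.re + α.im * Complex.I := (Complex.re_add_im α).symm
  have hα' : star α = α.re - α.im * Complex.I := by
    rw [Complex.star_def]; apply Complex.ext <;> simp
  rcases lt_trichotomy m n with h | rfl | h
  · rw [if_neg h.ne', if_neg (show ¬ n + 1 = m by omega), if_neg h.ne,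
      if_neg (show ¬ m = n + 1 by omega)]
    by_cases hmn : n = m + 1
    · subst hmn
      rw [Nat.add_sub_cancel, if_pos rfl, if_pos rfl, hα']
      push_cast
      ring
    · rw [if_neg (show ¬ n - 1 = m by omega), if_neg hmn]
      simp
  -- For `m = 0` the truncated `0 - 1 = 0` makes the lowering term look diagonal, but its
  -- coefficient contains `√0`.
  · rcases m with _ | m <;> simp
  · rw [if_neg h.ne, if_neg (show ¬ n - 1 = m by omega), if_neg h.ne',
      if_neg (show ¬ n = m + 1 by omega)]
    by_cases hmn : m = n + 1
    · rw [if_pos hmn.symm, if_pos hmn]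
      push_cast
      linear_combination (χ : ℂ) * (((n : ℂ) - r) * (Real.sqrt ((n : ℝ) + 1) : ℂ)) * hα
    · rw [if_neg (Ne.symm hmn), if_neg hmn]
      simp

end Blockade

/-! ### Propagators of constant and concatenated Hamiltonians -/

section Propagator

variable {n : Type*} [Fintype n] [DecidableEq n]

open scoped Matrix.Norms.L2Operator in
theorem hasDerivAt_exp_smul_apply (A : Matrix n n ℂ) (t : ℝ) (i j : n) :
    HasDerivAt (fun s : ℝ => (exp (s • A)) i j) ((A * exp (t • A)) i j) t := by
  have h := (hasStrictDerivAt_exp_smul_const' (𝕂 := ℝ) A t).hasDerivAt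
  let L : Matrix n n ℂ →L[ℝ] ℂ := (Matrix.entryLinearMap ℝ ℂ i j).toContinuousLinearMap
  exact L.hasFDerivAt.comp_hasDerivAt t h

theorem continuous_exp_smul (A : Matrix n n ℂ) : Continuous fun s : ℝ => exp (s • A) :=
  continuous_matrix fun i j =>
    continuous_iff_continuousAt.2 fun t => (hasDerivAt_exp_smul_apply A t i j).continuousAt

theorem isPropagator_const (H : Matrix n n ℂ) (T : ℝ) :
    IsPropagator (fun _ => H) T fun s => exp (s • (-(Complex.I • H))) where
  integrable i j := intervalIntegrable_const
  continuousOn := (continuous_exp_smul _).continuousOn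
  eq t ht i j := by
    have hd : ∀ s ∈ Set.uIcc 0 t, HasDerivAt (fun s : ℝ => (exp (s • (-(Complex.I • H)))) i j)
        (-Complex.I * (H * exp (s • (-(Complex.I • H)))) i j) s := by
      intro s _
      refine (hasDerivAt_exp_smul_apply (-(Complex.I • H)) s i j).congr_deriv ?_
      rw [← neg_smul, smul_mul_assoc, Matrix.smul_apply, smul_eq_mul]
    have hc : Continuous fun s : ℝ => -Complex.I * (H * exp (s • (-(Complex.I • H)))) i j :=
      continuous_const.mul ((continuous_const.mul (continuous_exp_smul _)).matrix_elem i j)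
    have h := intervalIntegral.integral_eq_sub_of_hasDerivAt hd (hc.intervalIntegrable 0 t)
    rw [intervalIntegral.integral_const_mul] at h
    simp only [zero_smul, exp_zero] at h
    linear_combination -h

theorem IsPropagator.apply_zero {H U : ℝ → Matrix n n ℂ} {T : ℝ} (h : IsPropagator H T U)
    (hT : 0 ≤ T) : U 0 = 1 := by
  ext i j
  simpa using h.eq 0 ⟨le_rfl, hT⟩ i j

theorem IsPropagator.intervalIntegrable_mul {H U : ℝ → Matrix n n ℂ} {T : ℝ}
    (h : IsPropagator H T U) (hT : 0 ≤ T) (i j : n) :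
    IntervalIntegrable (fun s => (H s * U s) i j) MeasureTheory.volume 0 T := by
  simp only [Matrix.mul_apply]
  have hk : ∀ k ∈ Finset.univ, IntervalIntegrable (fun s => H s i k * U s k j)
      MeasureTheory.volume 0 T := fun k _ => (h.integrable i k).mul_continuousOn (by
    rw [Set.uIcc_of_le hT]
    exact fun s hs => ((continuous_id.matrix_elem k j).tendsto _).comp (h.continuousOn s hs))
  simpa [Finset.sum_fn] using IntervalIntegrable.sum _ hk

/-- Concatenation of propagators. -/
theorem IsPropagator.concat {H₁ U₁ H₂ U₂ : ℝ → Matrix n n ℂ} {T₁ T₂ : ℝ}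
    (h₁ : IsPropagator H₁ T₁ U₁) (h₂ : IsPropagator H₂ T₂ U₂) (hT₁ : 0 ≤ T₁) (hT₂ : 0 ≤ T₂) :
    IsPropagator (fun t => if t ≤ T₁ then H₁ t else H₂ (t - T₁)) (T₁ + T₂)
      (fun t => if t ≤ T₁ then U₁ t else U₂ (t - T₁) * U₁ T₁) := by
  set H : ℝ → Matrix n n ℂ := fun t => if t ≤ T₁ then H₁ t else H₂ (t - T₁) with hH
  set U : ℝ → Matrix n n ℂ := fun t => if t ≤ T₁ then U₁ t else U₂ (t - T₁) * U₁ T₁ with hU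
  have hle : T₁ ≤ T₁ + T₂ := by linarith
  have hH₁ : ∀ t, t ≤ T₁ → H t = H₁ t := fun t ht => if_pos ht
  have hU₁ : ∀ t, t ≤ T₁ → U t = U₁ t := fun t ht => if_pos ht
  have hH₂ : ∀ t, T₁ < t → H t = H₂ (t - T₁) := fun t ht => if_neg ht.not_ge
  -- The two branches agree at `T₁` because `U₂ 0 = 1`; this gives continuity at the junction.
  have hU₂ : ∀ t, T₁ ≤ t → U t = U₂ (t - T₁) * U₁ T₁ := by
    intro t ht
    rcases ht.eq_or_lt with rfl | h
    · rw [hU₁ _ le_rfl, sub_self, h₂.apply_zero hT₂, one_mul]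
    · exact if_neg h.not_ge
  have hshift : ∀ f : ℝ → ℂ, IntervalIntegrable f MeasureTheory.volume 0 T₂ →
      IntervalIntegrable (fun s => f (s - T₁)) MeasureTheory.volume T₁ (T₁ + T₂) := by
    intro f hf
    have := hf.comp_sub_right T₁
    rwa [zero_add, add_comm T₂] at this
  have hcont : ContinuousOn U (Set.Icc 0 (T₁ + T₂)) := by
    rw [← Set.Icc_union_Icc_eq_Icc hT₁ hle]
    refine ContinuousOn.union_of_isClosed ?_ ?_ isClosed_Icc isClosed_Icc
    · exact h₁.continuousOn.congr fun t ht => hU₁ t ht.2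
    · refine ContinuousOn.congr ?_ fun t ht => hU₂ t ht.1
      refine ContinuousOn.mul (h₂.continuousOn.comp (by fun_prop) ?_) continuousOn_const
      intro t ht
      exact ⟨by linarith [ht.1], by linarith [ht.2]⟩
  have hint : ∀ i j, IntervalIntegrable (fun s => H s i j) MeasureTheory.volume 0 (T₁ + T₂) := by
    intro i j
    refine IntervalIntegrable.trans (b := T₁) ?_ ?_
    · refine (h₁.integrable i j).congr fun s hs => ?_
      rw [Set.uIoc_of_le hT₁] at hs
      simp only [hH₁ s hs.2]
    · refine (hshift _ (h₂.integrable i j)).congr fun s hs => ?_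
      rw [Set.uIoc_of_le hle] at hs
      simp only [hH₂ s hs.1]
  refine ⟨hint, hcont, fun t ht i j => ?_⟩
  have hfirst : ∀ t, 0 ≤ t → t ≤ T₁ → ∫ s in (0 : ℝ)..t, (H s * U s) i j =
      ∫ s in (0 : ℝ)..t, (H₁ s * U₁ s) i j := by
    intro t ht0 ht
    refine intervalIntegral.integral_congr fun s hs => ?_
    rw [Set.uIcc_of_le ht0] at hs
    simp only [hH₁ s (hs.2.trans ht), hU₁ s (hs.2.trans ht)]
  rcases le_or_gt t T₁ with htT | htT
  · rw [hU₁ t htT, hfirst t ht.1 htT]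
    exact h₁.eq t ⟨ht.1, htT⟩ i j
  · have hk : ∀ k ∈ Finset.univ, IntervalIntegrable (fun s => H s i k * U s k j)
        MeasureTheory.volume 0 (T₁ + T₂) := fun k _ => (hint i k).mul_continuousOn (by
      rw [Set.uIcc_of_le (hT₁.trans hle)]
      exact fun s hs => ((continuous_id.matrix_elem k j).tendsto _).comp (hcont s hs))
    have hprod : IntervalIntegrable (fun s => (H s * U s) i j) MeasureTheory.volume 0 (T₁ + T₂) := by
      simpa [Finset.sum_fn, Matrix.mul_apply] using IntervalIntegrable.sum _ hk
    have hsub : ∀ a b, 0 ≤ a → a ≤ b → b ≤ T₁ + T₂ →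
        IntervalIntegrable (fun s => (H s * U s) i j) MeasureTheory.volume a b := by
      intro a b ha hab hb
      refine hprod.mono_set ?_
      rw [Set.uIcc_of_le hab, Set.uIcc_of_le (hT₁.trans hle)]
      exact Set.Icc_subset_Icc ha hb
    rw [← intervalIntegral.integral_add_adjacent_intervals (hsub 0 T₁ le_rfl hT₁ hle)
      (hsub T₁ t hT₁ htT.le ht.2), hfirst T₁ hT₁ le_rfl]
    have hsecond : ∫ s in T₁..t, (H s * U s) i j =
        ∑ k, (∫ s in (0 : ℝ)..(t - T₁), (H₂ s * U₂ s) i k) * U₁ T₁ k j := by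
      have h1 : ∫ s in T₁..t, (H s * U s) i j =
          ∫ s in T₁..t, (fun s => ∑ k, (H₂ s * U₂ s) i k * U₁ T₁ k j) (s - T₁) := by
        refine intervalIntegral.integral_congr_ae (Filter.Eventually.of_forall fun s hs => ?_)
        rw [Set.uIoc_of_le htT.le] at hs
        rw [hH₂ s hs.1, hU₂ s hs.1.le, ← mul_assoc, Matrix.mul_apply]
      rw [h1, intervalIntegral.integral_comp_sub_right
        (fun s => ∑ k, (H₂ s * U₂ s) i k * U₁ T₁ k j) T₁, sub_self,
        intervalIntegral.integral_finsetSum]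
      · simp only [intervalIntegral.integral_mul_const]
      · intro k _
        refine IntervalIntegrable.mul_const ((h₂.intervalIntegrable_mul hT₂ i k).mono_set ?_) _
        rw [Set.uIcc_of_le (by linarith), Set.uIcc_of_le hT₂]
        exact Set.Icc_subset_Icc le_rfl (by linarith [ht.2])
    have e1 := h₁.eq T₁ ⟨hT₁, le_rfl⟩ i j
    have e2 : ∀ k, U₂ (t - T₁) i k = (1 : Matrix n n ℂ) i k
        - Complex.I * ∫ s in (0 : ℝ)..(t - T₁), (H₂ s * U₂ s) i k :=
      h₂.eq (t - T₁) ⟨by linarith, by linarith [ht.2]⟩ i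
    rw [hsecond, hU₂ t htT.le, Matrix.mul_apply]
    simp only [e2, sub_mul, Finset.sum_sub_distrib, mul_assoc]
    rw [← Matrix.mul_apply, one_mul, ← Finset.mul_sum]
    linear_combination e1

end Propagator

/-! ### Exact realization with a real drive -/

section Reachable

/-- `V` is reached at time `T` by the projected drive Hamiltonian with a real `α`. -/
def ReachedAt (χ Δ₀ : ℝ) (r : ℕ) (T : ℝ) (V : Matrix (Fin (r + 1)) (Fin (r + 1)) ℂ) : Prop :=
  ∃ α : ℝ → ℂ, Measurable α ∧ (∃ C : ℝ, ∀ t, ‖α t‖ ≤ C) ∧ (∀ t, (α t).im = 0) ∧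
    ∃ U : ℝ → Matrix (Fin (r + 1)) (Fin (r + 1)) ℂ,
      IsPropagator (fun t => blockade r (driveHamiltonian χ Δ₀ r (α t))) T U ∧ U T = V

theorem ReachedAt.mul {χ Δ₀ : ℝ} {r : ℕ} {T₁ T₂ : ℝ} (hT₁ : 0 ≤ T₁) (hT₂ : 0 ≤ T₂)
    {V₁ V₂ : Matrix (Fin (r + 1)) (Fin (r + 1)) ℂ} (h₂ : ReachedAt χ Δ₀ r T₂ V₂)
    (h₁ : ReachedAt χ Δ₀ r T₁ V₁) : ReachedAt χ Δ₀ r (T₁ + T₂) (V₂ * V₁) := by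
  obtain ⟨α₂, hm₂, ⟨C₂, hC₂⟩, hr₂, U₂, hU₂, rfl⟩ := h₂
  obtain ⟨α₁, hm₁, ⟨C₁, hC₁⟩, hr₁, U₁, hU₁, rfl⟩ := h₁
  refine ⟨fun t => if t ≤ T₁ then α₁ t else α₂ (t - T₁),
    Measurable.ite measurableSet_Iic hm₁ (hm₂.comp (measurable_id.sub_const T₁)),
    ⟨max C₁ C₂, fun t => ?_⟩, fun t => ?_,
    fun t => if t ≤ T₁ then U₁ t else U₂ (t - T₁) * U₁ T₁, ?_, ?_⟩
  · simp only
    split_ifs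
    · exact (hC₁ t).trans (le_max_left _ _)
    · exact (hC₂ _).trans (le_max_right _ _)
  · simp only
    split_ifs
    · exact hr₁ t
    · exact hr₂ _
  · convert hU₁.concat hU₂ hT₁ hT₂ using 2 with t
    simp only
    split_ifs <;> rfl
  · rcases hT₂.eq_or_lt with rfl | h
    · simp [hU₂.apply_zero le_rfl]
    · simp [h]

theorem reachedAt_exp {χ : ℝ} (Δ₀ : ℝ) (r : ℕ) (hχ : χ ≠ 0) (v t : ℝ) :
    ReachedAt χ Δ₀ r t (exp (t • (-(Complex.I • (drift χ Δ₀ r + v • controlRe r))))) := by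
  refine ⟨fun _ => ((v / χ : ℝ) : ℂ), measurable_const, ⟨_, fun _ => le_rfl⟩,
    fun _ => Complex.ofReal_im _, _, isPropagator_const _ t, ?_⟩
  rw [blockade_driveHamiltonian, Complex.ofReal_re, Complex.ofReal_im, mul_div_cancel₀ _ hχ,
    Complex.coe_smul]
  simp

/-- The matrices reached by the projected drive Hamiltonian with a real `α` in a time `T ≥ 0`. -/
def reachable (χ Δ₀ : ℝ) (r : ℕ) : Submonoid (Matrix (Fin (r + 1)) (Fin (r + 1)) ℂ) where
  carrier := {V | ∃ T : ℝ, 0 ≤ T ∧ ReachedAt χ Δ₀ r T V}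
  one_mem' := ⟨0, le_rfl, fun _ => 0, measurable_const, ⟨0, by simp⟩, by simp, _,
    isPropagator_const _ 0, by simp⟩
  mul_mem' := by
    rintro V₂ V₁ ⟨T₂, hT₂, h₂⟩ ⟨T₁, hT₁, h₁⟩
    exact ⟨T₁ + T₂, add_nonneg hT₁ hT₂, h₂.mul hT₁ hT₂ h₁⟩

theorem star_drift (χ Δ₀ : ℝ) (r : ℕ) : star (drift χ Δ₀ r) = drift χ Δ₀ r := by
  rw [drift, Matrix.star_eq_conjTranspose, Matrix.diagonal_conjTranspose]
  congr 1
  ext k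
  simp

theorem star_controlRe (r : ℕ) : star (controlRe r) = controlRe r := by
  simp [controlRe, Matrix.star_eq_conjTranspose, add_comm,
    Matrix.conjTranspose_single]

theorem star_controlIm (r : ℕ) : star (controlIm r) = controlIm r := by
  ext m n
  rw [Matrix.star_apply, controlIm_apply, controlIm_apply]
  simp only [star_mul', star_sub, apply_ite star, star_zero, Complex.star_def, Complex.conj_I,
    Complex.conj_ofReal]
  ring

theorem trace_controlRe (r : ℕ) : (controlRe r).trace = 0 :=
  Finset.sum_eq_zero fun k _ => by simp [controlRe_apply]

theorem I_smul_mem_skewAdjoint {n : Type*} [Fintype n] [DecidableEq n] {H : Matrix n n ℂ}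
    (hH : star H = H) : Complex.I • H ∈ skewAdjoint (Matrix n n ℂ) := by
  rw [skewAdjoint.mem_iff, star_smul, hH]; simp

/-- The generators `-i (H_d + v H_{c,R})` of the forward flows. -/
def driveGenerators (χ Δ₀ : ℝ) (r : ℕ) : Set (Matrix (Fin (r + 1)) (Fin (r + 1)) ℂ) :=
  Set.range fun v : ℝ => -(Complex.I • (drift χ Δ₀ r + v • controlRe r))

theorem driveGenerators_subset (χ Δ₀ : ℝ) (r : ℕ) :
    driveGenerators χ Δ₀ r ⊆ skewAdjoint (Matrix (Fin (r + 1)) (Fin (r + 1)) ℂ) := by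
  rintro _ ⟨v, rfl⟩
  refine neg_mem (I_smul_mem_skewAdjoint ?_)
  rw [star_add, star_smul, star_drift, star_controlRe]; simp

theorem drift_control_mem_of_driveGenerators_subset {χ Δ₀ : ℝ} {r : ℕ}
    {W : Submodule ℝ (Matrix (Fin (r + 1)) (Fin (r + 1)) ℂ)} (h : driveGenerators χ Δ₀ r ⊆ W) :
    Complex.I • drift χ Δ₀ r ∈ W ∧ Complex.I • controlRe r ∈ W := by
  have h0 : Complex.I • drift χ Δ₀ r ∈ W := by
    have := W.neg_mem (h ⟨0, rfl⟩)
    simpa using this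
  refine ⟨h0, ?_⟩
  have h1 := W.neg_mem (h ⟨1, rfl⟩)
  rw [neg_neg, one_smul, smul_add] at h1
  exact (W.add_mem_iff_right h0).1 h1

theorem unitaryGroup_le_reachable {χ Δ₀ : ℝ} {r : ℕ} (hχ : χ ≠ 0)
    (hr : (r : ℝ) ≠ 1 - 2 * Δ₀ / χ) (htr : (drift χ Δ₀ r).trace ≠ 0) :
    Matrix.unitaryGroup (Fin (r + 1)) ℂ ≤ reachable χ Δ₀ r := by
  refine unitaryGroup_le_of_generates (driveGenerators χ Δ₀ r) (driveGenerators_subset χ Δ₀ r) ?_ _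
    ?_
  · intro W hAW hW x hx
    obtain ⟨hd, hc⟩ := drift_control_mem_of_driveGenerators_subset hAW
    refine skewAdjoint_mem_of_trace_ne_zero (fun y hy => traceless_mem hχ hr hW hd hc hy)
      (I_smul_mem_skewAdjoint (star_drift χ Δ₀ r)) hd ?_ hx
    rw [Matrix.trace_smul]
    exact smul_ne_zero Complex.I_ne_zero htr
  · rintro _ ⟨v, rfl⟩ t ht
    exact ⟨t, ht, reachedAt_exp Δ₀ r hχ v t⟩

/-- The scalar multiples of the elements of a submonoid. -/
def scalarMultiples {n : Type*} [Fintype n] [DecidableEq n] (S : Submonoid (Matrix n n ℂ)) :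
    Submonoid (Matrix n n ℂ) where
  carrier := {V | ∃ c : ℂ, ∃ s ∈ S, V = c • s}
  one_mem' := ⟨1, 1, S.one_mem, by simp⟩
  mul_mem' := by
    rintro _ _ ⟨c, s, hs, rfl⟩ ⟨c', s', hs', rfl⟩
    exact ⟨c * c', s * s', S.mul_mem hs hs', by rw [smul_mul_smul_comm]⟩

/-- With a traceless drift the generators miss `i 1`. Adjoining it yields every unitary only up to a
scalar. To remove the scalar, take an `(r + 1)`-th root `W = c • s` of `V` with `s` reachable and
both determinants `1`: then `c ^ (r + 1) = 1`, so `V = s ^ (r + 1)`. -/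
theorem specialUnitaryGroup_le_reachable {χ Δ₀ : ℝ} {r : ℕ} (hχ : χ ≠ 0)
    (hr : (r : ℝ) ≠ 1 - 2 * Δ₀ / χ) :
    Matrix.specialUnitaryGroup (Fin (r + 1)) ℂ ≤ reachable χ Δ₀ r := by
  by_cases htr : (drift χ Δ₀ r).trace = 0
  swap
  · exact fun V hV => unitaryGroup_le_reachable hχ hr htr (Matrix.mem_specialUnitaryGroup_iff.1 hV).1
  intro V hV
  obtain ⟨W, hW, rfl⟩ := exists_pow_eq_of_mem_specialUnitaryGroup hV (k := r + 1) (by omega)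
  obtain ⟨hWu, hWd⟩ := Matrix.mem_specialUnitaryGroup_iff.1 hW
  have hone : Complex.I • (1 : Matrix (Fin (r + 1)) (Fin (r + 1)) ℂ) ∈
      skewAdjoint (Matrix (Fin (r + 1)) (Fin (r + 1)) ℂ) := I_smul_mem_skewAdjoint (star_one _)
  have hle : Matrix.unitaryGroup (Fin (r + 1)) ℂ ≤
      scalarMultiples (reachable χ Δ₀ r ⊓ Matrix.specialUnitaryGroup (Fin (r + 1)) ℂ) := by
    refine unitaryGroup_le_of_generates (insert (Complex.I • 1) (driveGenerators χ Δ₀ r)) ?_ ?_ _ ?_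
    · exact Set.insert_subset hone (driveGenerators_subset χ Δ₀ r)
    · intro W hAW hW x hx
      obtain ⟨h1, h2⟩ := Set.insert_subset_iff.1 hAW
      obtain ⟨hd, hc⟩ := drift_control_mem_of_driveGenerators_subset h2
      refine skewAdjoint_mem_of_trace_ne_zero (fun y hy => traceless_mem hχ hr hW hd hc hy)
        hone h1 ?_ hx
      rw [Matrix.trace_smul, Matrix.trace_one]
      exact smul_ne_zero Complex.I_ne_zero (by simp; norm_cast)
    · intro a ha t ht
      rcases ha with rfl | hv
      · refine ⟨Complex.exp (t * Complex.I), 1, one_mem _, ?_⟩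
        have h : t • Complex.I • (1 : Matrix (Fin (r + 1)) (Fin (r + 1)) ℂ) =
            Matrix.diagonal fun _ => t * Complex.I := by
          rw [← Matrix.smul_one_eq_diagonal, ← Complex.coe_smul, smul_smul]
        rw [h, Matrix.exp_diagonal, Matrix.smul_one_eq_diagonal]
        congr 1
        ext i
        rw [Pi.coe_exp, Complex.exp_eq_exp_ℂ]
      · have hsk := driveGenerators_subset χ Δ₀ r hv
        obtain ⟨v, rfl⟩ := hv
        refine ⟨1, _, ⟨⟨t, ht, reachedAt_exp Δ₀ r hχ v t⟩,
          Matrix.mem_specialUnitaryGroup_iff.2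
            ⟨exp_mem_unitaryGroup (skewAdjoint.smul_mem t hsk), ?_⟩⟩, (one_smul _ _).symm⟩
        rw [det_exp_of_skewAdjoint (skewAdjoint.smul_mem t hsk)]
        simp [htr, trace_controlRe]
  obtain ⟨c, s, ⟨hs, hsu⟩, rfl⟩ := hle hWu
  rw [Matrix.det_smul, (Matrix.mem_specialUnitaryGroup_iff.1 hsu).2, mul_one, Fintype.card_fin]
    at hWd
  rw [smul_pow, hWd, one_smul]
  exact pow_mem hs _

/-- Reachability allows time `0`. Running the bare drift for one unit of time first, and
compensating it in the target, makes the total time positive. -/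
theorem realizedByRealDrive_of_mul_mem_reachable {χ : ℝ} (Δ₀ : ℝ) (r : ℕ) (hχ : χ ≠ 0)
    {V : Matrix (Fin (r + 1)) (Fin (r + 1)) ℂ}
    (hV : V * exp (Complex.I • drift χ Δ₀ r) ∈ reachable χ Δ₀ r) :
    RealizedByRealDrive χ Δ₀ r V := by
  obtain ⟨T, hT, h⟩ := hV
  refine ⟨1 + T, by linarith, ?_⟩
  have h2 := h.mul zero_le_one hT (reachedAt_exp Δ₀ r hχ 0 1)
  rw [mul_assoc, zero_smul, add_zero, one_smul,
    ← Matrix.exp_add_of_commute _ _ (Commute.neg_right (Commute.refl (Complex.I • drift χ Δ₀ r))),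
    add_neg_cancel,
    exp_zero, mul_one] at h2
  exact h2

theorem realizedByRealDrive_of_mem_unitaryGroup {χ Δ₀ : ℝ} {r : ℕ} (hχ : χ ≠ 0)
    (hr : (r : ℝ) ≠ 1 - 2 * Δ₀ / χ) (htr : (drift χ Δ₀ r).trace ≠ 0)
    {V : Matrix (Fin (r + 1)) (Fin (r + 1)) ℂ} (hV : V ∈ Matrix.unitaryGroup (Fin (r + 1)) ℂ) :
    RealizedByRealDrive χ Δ₀ r V :=
  realizedByRealDrive_of_mul_mem_reachable Δ₀ r hχ (unitaryGroup_le_reachable hχ hr htr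
    (mul_mem hV (exp_mem_unitaryGroup (I_smul_mem_skewAdjoint (star_drift χ Δ₀ r)))))

theorem realizedByRealDrive_of_mem_specialUnitaryGroup {χ Δ₀ : ℝ} {r : ℕ} (hχ : χ ≠ 0)
    (hr : (r : ℝ) ≠ 1 - 2 * Δ₀ / χ) {V : Matrix (Fin (r + 1)) (Fin (r + 1)) ℂ}
    (hV : V ∈ Matrix.specialUnitaryGroup (Fin (r + 1)) ℂ) : RealizedByRealDrive χ Δ₀ r V := by
  by_cases htr : (drift χ Δ₀ r).trace = 0
  · have hsk := I_smul_mem_skewAdjoint (star_drift χ Δ₀ r)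
    refine realizedByRealDrive_of_mul_mem_reachable Δ₀ r hχ
      (specialUnitaryGroup_le_reachable hχ hr (mul_mem hV ?_))
    refine Matrix.mem_specialUnitaryGroup_iff.2 ⟨exp_mem_unitaryGroup hsk, ?_⟩
    rw [det_exp_of_skewAdjoint hsk, Matrix.trace_smul, htr, smul_zero, Complex.exp_zero]
  · exact realizedByRealDrive_of_mem_unitaryGroup hχ hr htr
      (Matrix.mem_specialUnitaryGroup_iff.1 hV).1

end Reachable

/-! ### The dynamical Lie groups -/

section DynamicalLieGroup

attribute [local instance 100] LieRing.ofAssociativeRing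

variable {χ Δ₀ : ℝ} {r : ℕ} {ι : Type*} {Hc : ι → Matrix (Fin (r + 1)) (Fin (r + 1)) ℂ}

theorem traceless_mem_dynamicalLieAlgebra (hχ : χ ≠ 0) (hr : (r : ℝ) ≠ 1 - 2 * Δ₀ / χ)
    {j : ι} (hj : Hc j = controlRe r) {x : Matrix (Fin (r + 1)) (Fin (r + 1)) ℂ}
    (hx : x ∈ skewAdjoint _) (htr : x.trace = 0) :
    x ∈ dynamicalLieAlgebra (drift χ Δ₀ r) Hc := by
  refine traceless_mem (W := (dynamicalLieAlgebra (drift χ Δ₀ r) Hc).toSubmodule) hχ hr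
    (fun a ha b hb => (dynamicalLieAlgebra (drift χ Δ₀ r) Hc).lie_mem ha hb) ?_ ?_ hx htr
  · exact LieSubalgebra.subset_lieSpan (Set.mem_insert _ _)
  · exact LieSubalgebra.subset_lieSpan (Set.mem_insert_of_mem _ ⟨j, by simp only [hj]⟩)

theorem specialUnitaryGroup_le_dynamicalLieGroup (hχ : χ ≠ 0) (hr : (r : ℝ) ≠ 1 - 2 * Δ₀ / χ)
    {j : ι} (hj : Hc j = controlRe r) :
    Matrix.specialUnitaryGroup (Fin (r + 1)) ℂ ≤ dynamicalLieGroup (drift χ Δ₀ r) Hc := by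
  intro V hV
  obtain ⟨X, hX, htr, rfl⟩ := exists_traceless_skewAdjoint_exp_eq hV
  exact Submonoid.subset_closure ⟨X, traceless_mem_dynamicalLieAlgebra hχ hr hj hX htr, rfl⟩

theorem dynamicalLieAlgebra_subset_skewAdjoint (hHc : ∀ j, star (Hc j) = Hc j)
    {x : Matrix (Fin (r + 1)) (Fin (r + 1)) ℂ} (hx : x ∈ dynamicalLieAlgebra (drift χ Δ₀ r) Hc) :
    x ∈ skewAdjoint (Matrix (Fin (r + 1)) (Fin (r + 1)) ℂ) := by
  induction hx using LieSubalgebra.lieSpan_induction with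
  | mem y hy =>
    rcases hy with rfl | ⟨j, rfl⟩
    · exact I_smul_mem_skewAdjoint (star_drift χ Δ₀ r)
    · exact I_smul_mem_skewAdjoint (hHc j)
  | zero => exact zero_mem _
  | add y z _ _ hy hz => exact add_mem hy hz
  | smul c y _ hy => exact skewAdjoint.smul_mem c hy
  | lie y z _ _ hy hz =>
    rw [skewAdjoint.mem_iff] at hy hz ⊢
    rw [Ring.lie_def, star_sub, star_mul, star_mul, hy, hz]
    noncomm_ring

theorem dynamicalLieGroup_eq_unitaryGroup (hχ : χ ≠ 0) (hr : (r : ℝ) ≠ 1 - 2 * Δ₀ / χ)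
    (htr : (drift χ Δ₀ r).trace ≠ 0) (hHc : ∀ j, star (Hc j) = Hc j)
    {j : ι} (hj : Hc j = controlRe r) :
    dynamicalLieGroup (drift χ Δ₀ r) Hc = Matrix.unitaryGroup (Fin (r + 1)) ℂ := by
  refine le_antisymm (Submonoid.closure_le.2 ?_) fun V hV => ?_
  · rintro _ ⟨X, hX, rfl⟩
    exact exp_mem_unitaryGroup (dynamicalLieAlgebra_subset_skewAdjoint hHc hX)
  · obtain ⟨X, hX, rfl⟩ := exists_skewAdjoint_exp_eq hV
    refine Submonoid.subset_closure ⟨X, ?_, rfl⟩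
    refine skewAdjoint_mem_of_trace_ne_zero
      (W := (dynamicalLieAlgebra (drift χ Δ₀ r) Hc).toSubmodule)
      (fun y hy hy0 => traceless_mem_dynamicalLieAlgebra hχ hr hj hy hy0)
      (I_smul_mem_skewAdjoint (star_drift χ Δ₀ r))
      (LieSubalgebra.subset_lieSpan (Set.mem_insert _ _)) ?_ hX
    rw [Matrix.trace_smul]
    exact smul_ne_zero Complex.I_ne_zero htr

end DynamicalLieGroup

end KerrControl

end

theorem mainTheorem1 (χ Δ₀ : ℝ) (r : ℕ) (hχ : χ ≠ 0) (hr : (r : ℝ) ≠ 1 - 2 * Δ₀ / χ) :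
    -- the projected drive Hamiltonian is a control system with this drift and these two controls
    (∀ α : ℂ, KerrControl.blockade r (KerrControl.driveHamiltonian χ Δ₀ r α) =
      KerrControl.drift χ Δ₀ r + ((χ * α.re : ℝ) : ℂ) • KerrControl.controlRe r
        + ((χ * α.im : ℝ) : ℂ) • KerrControl.controlIm r) ∧
    -- dynamical Lie group when `Im α(t) = 0`, i.e. with the single control `H_{c,R}`
    (Matrix.specialUnitaryGroup (Fin (r + 1)) ℂ ≤
      KerrControl.dynamicalLieGroup (KerrControl.drift χ Δ₀ r) ![KerrControl.controlRe r]) ∧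
    ((KerrControl.drift χ Δ₀ r).trace ≠ 0 →
      KerrControl.dynamicalLieGroup (KerrControl.drift χ Δ₀ r) ![KerrControl.controlRe r] =
        Matrix.unitaryGroup (Fin (r + 1)) ℂ) ∧
    -- dynamical Lie group with both controls
    (Matrix.specialUnitaryGroup (Fin (r + 1)) ℂ ≤
      KerrControl.dynamicalLieGroup (KerrControl.drift χ Δ₀ r)
        ![KerrControl.controlRe r, KerrControl.controlIm r]) ∧
    ((KerrControl.drift χ Δ₀ r).trace ≠ 0 →
      KerrControl.dynamicalLieGroup (KerrControl.drift χ Δ₀ r)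
          ![KerrControl.controlRe r, KerrControl.controlIm r] =
        Matrix.unitaryGroup (Fin (r + 1)) ℂ) ∧
    -- universal control, even with `Im α(t) = 0`
    (∀ V ∈ Matrix.specialUnitaryGroup (Fin (r + 1)) ℂ,
      KerrControl.RealizedByRealDrive χ Δ₀ r V) ∧
    ((KerrControl.drift χ Δ₀ r).trace ≠ 0 →
      ∀ V ∈ Matrix.unitaryGroup (Fin (r + 1)) ℂ, KerrControl.RealizedByRealDrive χ Δ₀ r V) := by
  refine ⟨KerrControl.blockade_driveHamiltonian χ Δ₀ r,
    KerrControl.specialUnitaryGroup_le_dynamicalLieGroup hχ hr (j := 0) rfl,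
    fun htr => KerrControl.dynamicalLieGroup_eq_unitaryGroup hχ hr htr (fun j => ?_) (j := 0) rfl,
    KerrControl.specialUnitaryGroup_le_dynamicalLieGroup hχ hr (j := 0) rfl,
    fun htr => KerrControl.dynamicalLieGroup_eq_unitaryGroup hχ hr htr (fun j => ?_) (j := 0) rfl,
    fun V hV => KerrControl.realizedByRealDrive_of_mem_specialUnitaryGroup hχ hr hV,
    fun htr V hV => KerrControl.realizedByRealDrive_of_mem_unitaryGroup hχ hr htr hV⟩
  · fin_cases j
    exact KerrControl.star_controlRe r
  · fin_cases j
    · exact KerrControl.star_controlRe r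
    · exact KerrControl.star_controlIm r
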